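/- **Theorem (Stable manifold theorem).** Let $M$ be a smooth closed (compact, without boundary) manifold of finite dimension $n$, let $g$ be a smooth Riemannian metric on $M$ and let $f:M\to\mathbb{R}$ be a Morse function, i.e. a smooth function at each of whose critical points the Hessian is nonsingular. Let $\nabla f$ be the gradient of $f$, defined by $g(\nabla f,\cdot)=df$, and for $q\in M$ let $\gamma_q:\mathbb{R}\to M$ be the trajectory of the negative gradient flow through $q$, i.e. $\dot\gamma_q(t)=-\nabla f(\gamma_q(t))$ for all $t\in\mathbb{R}$ and $\gamma_q(0)=q$. Let $\omega(q)$ (respectively $\alpha(q)$) be the set of all limits of $\gamma_q(t_k)$ along sequences $t_k\to\infty$ (respectively $t_k\to-\infty$). Let $x$ be a critical point of $f$ and put $$W^s(x)=\{q\in M\mid \omega(q)=\{x\}\},\qquad W^u(x)=\{q\in M\mid \alpha(q)=\{x\}\}.$$ Let $D\nabla f(x):T_xM\to T_xM$ be the linearization of the vector field $\nabla f$ at its zero $x$, and let $E^s\subset T_xM$ (respectively $E^u\subset T_xM$) be the sum of the eigenspaces of $D\nabla f(x)$ for positive (respectively negative) eigenvalues. Then: 1. $W^s(x)$ contains $x$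 and is an embedded smooth submanifold of $M$ without boundary, of dimension $\dim E^s$; its tangent space at $x$ is $E^s$. 2. $W^u(x)$ contains $x$ and is an embedded smooth submanifold of $M$ without boundary, of dimension $\dim E^u$; its tangent space at $x$ is $E^u$. -/

import Mathlib

open Set Filter
open scoped Manifold ContDiff Topology Bundle

noncomputable section

namespace MorseFlow

variable {n : ℕ} {M : Type*} [TopologicalSpace M]
  [ChartedSpace (EuclideanSpace ℝ (Fin n)) M]

/-- A critical point of `f`: a point at which the differential of `f` vanishes. -/
def IsCritical (f : M → ℝ) (x : M) : Prop :=
  mfderiv (𝓡 n) 𝓘(ℝ, ℝ) f x = 0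

/-- The Hessian form of `f` at `x`: the matrix of second partial derivatives of `f` in the
preferred chart at `x`, regarded as a bilinear form on the tangent space at `x`. (The tangent
space at `x` is by definition the coordinate space `ℝⁿ` of the preferred chart at `x`.) It does not
depend on the chart when `x` is a critical point. -/
def hessian (f : M → ℝ) (x : M) :
    TangentSpace (𝓡 n) x →L[ℝ] TangentSpace (𝓡 n) x →L[ℝ] ℝ :=
  (fderiv ℝ (fderiv ℝ (f ∘ (extChartAt (𝓡 n) x).symm)) (extChartAt (𝓡 n) x x) :
    EuclideanSpace ℝ (Fin n) →L[ℝ] EuclideanSpace ℝ (Fin n) →L[ℝ] ℝ)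

/-- The Hessian form of `f` at `x` is nonsingular. -/
def IsNondegenerateAt (f : M → ℝ) (x : M) : Prop :=
  ∀ ξ : TangentSpace (𝓡 n) x,
    (∀ η : TangentSpace (𝓡 n) x, hessian (n := n) f x ξ η = 0) → ξ = 0

variable (n) in
/-- A Morse function: a smooth function all of whose critical points are nondegenerate. -/
structure IsMorse (f : M → ℝ) : Prop where
  smooth : ContMDiff (𝓡 n) 𝓘(ℝ, ℝ) ∞ f
  nondegenerate : ∀ x : M, IsCritical (n := n) f x → IsNondegenerateAt (n := n) f x

/-- A trajectory through `q` of the vector field `X`: a curve `γ : ℝ → M` with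
`γ'(t) = X (γ t)` for all `t` and `γ 0 = q`. -/
def IsTrajectory (X : (p : M) → TangentSpace (𝓡 n) p) (q : M) (γ : ℝ → M) : Prop :=
  IsMIntegralCurve (I := 𝓡 n) γ X ∧ γ 0 = q

/-- The `ω`-limit of a curve: all limits of `γ (t k)` along sequences `t k → ∞`. -/
def omegaLimit {M : Type*} [TopologicalSpace M] (γ : ℝ → M) : Set M :=
  {p | ∃ t : ℕ → ℝ, Tendsto t atTop atTop ∧ Tendsto (fun k => γ (t k)) atTop (𝓝 p)}

/-- The `α`-limit of a curve: all limits of `γ (t k)` along sequences `t k → -∞`. -/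
def alphaLimit {M : Type*} [TopologicalSpace M] (γ : ℝ → M) : Set M :=
  {p | ∃ t : ℕ → ℝ, Tendsto t atTop atBot ∧ Tendsto (fun k => γ (t k)) atTop (𝓝 p)}

/-- The stable manifold of `x` for the vector field `X`: all points `q` such that the trajectory
through `q` has `ω`-limit `{x}`. (For a smooth vector field on a closed manifold there is exactly
one trajectory through each point.) -/
def stableManifold (X : (p : M) → TangentSpace (𝓡 n) p) (x : M) : Set M :=
  {q | ∃ γ : ℝ → M, IsTrajectory X q γ ∧ omegaLimit γ = {x}}

/-- The unstable manifold of `x` for the vector field `X`: all points `q` such that the trajectory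
through `q` has `α`-limit `{x}`. -/
def unstableManifold (X : (p : M) → TangentSpace (𝓡 n) p) (x : M) : Set M :=
  {q | ∃ γ : ℝ → M, IsTrajectory X q γ ∧ alphaLimit γ = {x}}

variable (n) in
/-- `W` is an embedded smooth `k`-dimensional submanifold (without boundary) of `M`: around each
of its points there is a smooth chart of `M` which carries `W` to the intersection of the chart's
image with a `k`-dimensional linear subspace of `ℝⁿ`. -/
def IsEmbeddedSubmanifold (k : ℕ) (W : Set M) : Prop :=
  ∀ p ∈ W, ∃ φ ∈ IsManifold.maximalAtlas (𝓡 n) ∞ M, p ∈ φ.source ∧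
    ∃ S : Submodule ℝ (EuclideanSpace ℝ (Fin n)), Module.finrank ℝ S = k ∧
      φ '' (φ.source ∩ W) = φ.target ∩ S

/-- The vectors at `p` tangent to the subset `W`: the velocities `γ'(0)` of smooth curves
`γ : (-ε, ε) → M` with values in `W` and `γ 0 = p`. For an embedded submanifold `W` this is the
tangent space of `W` at `p`. -/
def tangentVectors (W : Set M) (p : M) : Set (TangentSpace (𝓡 n) p) :=
  {v | ∃ (γ : ℝ → M) (ε : ℝ), 0 < ε ∧ ContMDiffOn 𝓘(ℝ, ℝ) (𝓡 n) ∞ γ (Ioo (-ε) ε) ∧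
    (∀ t ∈ Ioo (-ε) ε, γ t ∈ W) ∧ γ 0 = p ∧
    HasMFDerivAt 𝓘(ℝ, ℝ) (𝓡 n) γ 0 ((1 : ℝ →L[ℝ] ℝ).smulRight v)}

variable [IsManifold (𝓡 n) ∞ M]

/-- The linearization at `x` of a vector field `X`: the derivative at `x` of the fibre component of
`X` in the trivialization of the tangent bundle given by the preferred chart at `x`. At a zero `x`
of `X` this does not depend on the chart, and it is the composition of
`dX x : T_x M → T_{X x} TM ≃ T_x M ⊕ T_x M` with the projection to the second factor. -/
def linearization (X : (p : M) → TangentSpace (𝓡 n) p) (x : M) :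
    TangentSpace (𝓡 n) x →L[ℝ] TangentSpace (𝓡 n) x :=
  mfderiv (𝓡 n) 𝓘(ℝ, EuclideanSpace ℝ (Fin n))
    (fun q : M => ((trivializationAt (EuclideanSpace ℝ (Fin n)) (TangentSpace (𝓡 n)) x)
      (⟨q, X q⟩ : TangentBundle (𝓡 n) M)).2) x

variable (n M) in
/-- Smooth Riemannian metrics on `M`. -/
abbrev RiemannianMetric : Type _ :=
  Bundle.ContMDiffRiemannianMetric (𝓡 n) ∞ (EuclideanSpace ℝ (Fin n))
    (TangentSpace (𝓡 n) : M → Type)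

theorem existsUnique_gradient (g : RiemannianMetric n M) (f : M → ℝ) (q : M) :
    ∃! w : TangentSpace (𝓡 n) q, ∀ v : TangentSpace (𝓡 n) q,
      g.inner q w v = mfderiv (𝓡 n) 𝓘(ℝ, ℝ) f q v := by
  let L : EuclideanSpace ℝ (Fin n) →ₗ[ℝ] (EuclideanSpace ℝ (Fin n) →L[ℝ] ℝ) :=
    (g.inner q).toLinearMap
  have hL : Function.Injective L := by
    rw [injective_iff_map_eq_zero]
    intro w hw
    by_contra h
    have h1 := g.pos q w h
    have h2 : g.inner q w w = 0 := DFunLike.congr_fun hw w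
    exact absurd h2 h1.ne'
  have hd : Module.finrank ℝ (EuclideanSpace ℝ (Fin n)) =
      Module.finrank ℝ (EuclideanSpace ℝ (Fin n) →L[ℝ] ℝ) :=
    (InnerProductSpace.toDual ℝ (EuclideanSpace ℝ (Fin n))).toLinearEquiv.finrank_eq
  have hS : Function.Surjective L :=
    (LinearMap.injective_iff_surjective_of_finrank_eq_finrank hd).1 hL
  obtain ⟨w, hw⟩ := hS (mfderiv (𝓡 n) 𝓘(ℝ, ℝ) f q)
  refine ⟨w, fun v => DFunLike.congr_fun hw v, fun w' hw' => hL ?_⟩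
  rw [hw]
  ext v
  exact hw' v

/-- The gradient of `f` with respect to `g`: the vector field with `g (∇f, ·) = df`. -/
def gradient (g : RiemannianMetric n M) (f : M → ℝ) (q : M) : TangentSpace (𝓡 n) q :=
  (existsUnique_gradient g f q).choose

theorem inner_gradient (g : RiemannianMetric n M) (f : M → ℝ) (q : M)
    (v : TangentSpace (𝓡 n) q) :
    g.inner q (gradient g f q) v = mfderiv (𝓡 n) 𝓘(ℝ, ℝ) f q v :=
  (existsUnique_gradient g f q).choose_spec.1 v

/-- The negative gradient vector field `-∇f`. -/
def negGradient (g : RiemannianMetric n M) (f : M → ℝ) (q : M) : TangentSpace (𝓡 n) q :=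
  -gradient g f q

/-- The stable subspace at `x`: the sum of the eigenspaces of `D∇f(x)` for positive
eigenvalues. -/
def stableSubspace (g : RiemannianMetric n M) (f : M → ℝ) (x : M) :
    Submodule ℝ (TangentSpace (𝓡 n) x) :=
  ⨆ μ : {μ : ℝ // 0 < μ},
    Module.End.eigenspace (linearization (gradient g f) x).toLinearMap (μ : ℝ)

/-- The unstable subspace at `x`: the sum of the eigenspaces of `D∇f(x)` for negative
eigenvalues. -/
def unstableSubspace (g : RiemannianMetric n M) (f : M → ℝ) (x : M) :
    Submodule ℝ (TangentSpace (𝓡 n) x) :=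
  ⨆ μ : {μ : ℝ // μ < 0},
    Module.End.eigenspace (linearization (gradient g f) x).toLinearMap (μ : ℝ)

end MorseFlow

end

/-!
The proof replaces the negative gradient flow by a diffeomorphism, its time-`τ` map for a small
`τ > 0`, and works with the iterates of that map.

*Local theory.* Let `φ` be a smooth map with a hyperbolic fixed point whose derivative there is
diagonal with positive eigenvalues. Irwin's method considers the map
`u ↦ (P (u 0), (u (k + 1) - φ (u k))ₖ)` on bounded sequences, where `P` is the projection to the
contracting directions. It is smooth because superposition operators on bounded continuous
functions are (`contDiff_superposition`), and its linearization is invertible by hyperbolicity, so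
the inverse function theorem parametrizes the bounded orbits near the fixed point by the stable
subspace. This gives coordinates, tangent to the identity, in which the points whose orbits stay
near the fixed point form the stable subspace (`exists_stable_straightening`). The same
superposition operators, applied to the rescaled integral equation of an ordinary differential
equation, give local flows that are smooth in the initial value, with the expected derivative at a
zero (`exists_smooth_local_flow`).

*From local to global.* A point whose orbit converges to `x` could be near `x`, leave, and return;
in general the stable set is therefore only an immersed submanifold. Here `f` decreases strictly
along nonconstant orbits, so an orbit that leaves a neighbourhood of `x` loses a definite amount of
`f` and cannot start close to `x` and converge to `x` (`exists_nhds_forall_iterate_mem`).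
Conversely an orbit that stays in a compact neighbourhood containing no other fixed point converges
to `x` (`tendsto_iterate_of_forall_mem`). So the local coordinates are a slice chart for the stable
set at `x` (`exists_slice_chart`), and the iterates of the diffeomorphism carry it to every other
point (`isEmbeddedSubmanifold_stableSet`).

*The gradient.* In a chart, the gradient solves a linear system given by the metric, so it is a
smooth vector field. At a critical point its linearization represents the Hessian with respect to
the metric, so it is diagonalizable with nonzero real eigenvalues `μ`
(`exists_eigenbasis_chartField_gradient`), and the time-`τ` map of the negative gradient flow has
the eigenvalues `exp (-μ τ)`, which are less than `1` exactly when `μ > 0`. Compactness of the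
manifold makes the flow complete (`exists_flow`), and identifies the condition `ω(q) = {x}` with
the convergence of the iterates of the time-`τ` map (`omegaLimit_eq_singleton_iff`). The statement
for the unstable manifold is the one for the stable manifold of `-f`, whose flow is the
time-reversed one.
-/

namespace MorseFlow

open BoundedContinuousFunction

/-! ### Superposition operators on bounded continuous functions -/

section Superposition

variable {X : Type} [TopologicalSpace X]
  {E : Type} [NormedAddCommGroup E] {G : Type} [NormedAddCommGroup G]

section Pointwise

variable [NormedSpace ℝ E] [NormedSpace ℝ G]

variable (X) in
/-- Pointwise application of a bounded bilinear map to bounded continuous functions, as a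
continuous bilinear map. -/
noncomputable def pointwiseBilin {H : Type} [NormedAddCommGroup H] [NormedSpace ℝ H]
    (B : H →L[ℝ] E →L[ℝ] G) : (X →ᵇ H) →L[ℝ] (X →ᵇ E) →L[ℝ] (X →ᵇ G) :=
  LinearMap.mkContinuous₂
    (LinearMap.mk₂ ℝ
      (fun (A : X →ᵇ H) (h : X →ᵇ E) =>
        BoundedContinuousFunction.ofNormedAddCommGroup (fun x => B (A x) (h x))
          ((B.continuous.comp A.continuous).clm_apply h.continuous) (‖B‖ * ‖A‖ * ‖h‖) (fun x =>
            (B.le_opNorm₂ _ _).trans (by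
              gcongr
              · exact A.norm_coe_le_norm x
              · exact h.norm_coe_le_norm x)))
      (fun A B h => by ext x; simp) (fun c A h => by ext x; simp)
      (fun A h k => by ext x; simp) (fun c A h => by ext x; simp))
    ‖B‖ (fun A h => (BoundedContinuousFunction.norm_le (by positivity)).2 fun x =>
      (B.le_opNorm₂ _ _).trans (by
        gcongr
        · exact A.norm_coe_le_norm x
        · exact h.norm_coe_le_norm x))

/-- A shortcut for type class search. -/
noncomputable instance instNormedAddCommGroupBoundedFamily :
    NormedAddCommGroup (X →ᵇ (E →L[ℝ] G)) :=
  BoundedContinuousFunction.instNormedAddCommGroup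

variable (X E G) in
/-- Pointwise application of a bounded family of operators, as a continuous linear map. -/
noncomputable def pointwiseApply : (X →ᵇ (E →L[ℝ] G)) →L[ℝ] (X →ᵇ E) →L[ℝ] (X →ᵇ G) :=
  pointwiseBilin X (ContinuousLinearMap.id ℝ (E →L[ℝ] G))

end Pointwise

variable [ProperSpace E]

theorem exists_norm_comp_le {F : E → G} (hF : Continuous F) (u : X →ᵇ E) :
    ∃ C, ∀ x, ‖F (u x)‖ ≤ C := by
  obtain ⟨C, hC⟩ := (isCompact_closedBall (0 : E) ‖u‖).exists_bound_of_continuousOn hF.continuousOn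
  exact ⟨C, fun x => hC _ (by simpa using u.norm_coe_le_norm x)⟩

/-- The superposition operator `u ↦ F ∘ u` on bounded continuous functions. -/
noncomputable def superposition (X : Type) [TopologicalSpace X] (F : E → G) (hF : Continuous F)
    (u : X →ᵇ E) : X →ᵇ G :=
  BoundedContinuousFunction.ofNormedAddCommGroup (fun x => F (u x)) (hF.comp u.continuous)
    (exists_norm_comp_le hF u).choose (exists_norm_comp_le hF u).choose_spec

/-- The uniform continuity of `F` on bounded sets, in the form used for superposition operators. -/
theorem exists_delta_norm_sub_le {F : E → G} (hF : Continuous F) (R : ℝ) {ε : ℝ} (hε : 0 < ε) :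
    ∃ δ > 0, ∀ a b : E, ‖a‖ ≤ R → ‖b - a‖ ≤ δ → ‖F b - F a‖ ≤ ε := by
  have hu := (isCompact_closedBall (0 : E) (R + 1)).uniformContinuousOn_of_continuous
    hF.continuousOn
  obtain ⟨δ, hδ, h⟩ := Metric.uniformContinuousOn_iff_le.1 hu ε hε
  refine ⟨min δ 1, by positivity, fun a b ha hab => ?_⟩
  have hb : ‖b‖ ≤ R + 1 := by
    calc ‖b‖ = ‖a + (b - a)‖ := by congr 1; abel
      _ ≤ ‖a‖ + ‖b - a‖ := norm_add_le _ _
      _ ≤ R + 1 := add_le_add ha (hab.trans (min_le_right _ _))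
  rw [← dist_eq_norm]
  refine h b (by simpa using hb) a ?_ ?_
  · simpa using ha.trans (by linarith)
  · rw [dist_eq_norm]; exact hab.trans (min_le_left _ _)

theorem continuous_superposition (F : E → G) (hF : Continuous F) :
    Continuous (superposition X F hF) := by
  rw [Metric.continuous_iff]
  intro u ε hε
  obtain ⟨δ, hδ, h⟩ := exists_delta_norm_sub_le hF ‖u‖ (half_pos hε)
  refine ⟨δ, hδ, fun v hv => lt_of_le_of_lt ?_ (half_lt_self hε)⟩
  rw [BoundedContinuousFunction.dist_le (half_pos hε).le]
  intro x
  rw [dist_eq_norm]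
  refine h _ _ (u.norm_coe_le_norm x) ?_
  rw [← dist_eq_norm]
  exact (BoundedContinuousFunction.dist_coe_le_dist x).trans hv.le

variable [NormedSpace ℝ E] [NormedSpace ℝ G]

theorem hasFDerivAt_superposition {F : E → G} (hF : ContDiff ℝ 1 F) (u : X →ᵇ E) :
    HasFDerivAt (superposition X F hF.continuous)
      (pointwiseApply X E G (superposition X (fderiv ℝ F) (hF.continuous_fderiv one_ne_zero) u))
      u := by
  rw [hasFDerivAt_iff_isLittleO, Asymptotics.isLittleO_iff]
  intro ε hε
  obtain ⟨δ, hδ, h⟩ := exists_delta_norm_sub_le (hF.continuous_fderiv one_ne_zero) ‖u‖ hε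
  filter_upwards [Metric.closedBall_mem_nhds u hδ] with v hv
  rw [BoundedContinuousFunction.norm_le (by positivity)]
  intro x
  have hvx : ‖v x - u x‖ ≤ δ := by
    have := (v - u).norm_coe_le_norm x
    rw [mem_closedBall_iff_norm] at hv
    exact this.trans hv
  have key := (convex_closedBall (u x) δ).norm_image_sub_le_of_norm_hasFDerivWithin_le'
    (f := F) (f' := fderiv ℝ F) (φ := fderiv ℝ F (u x)) (C := ε) (x := u x) (y := v x)
    (fun y _ => (hF.differentiable one_ne_zero y).hasFDerivAt.hasFDerivWithinAt)
    (fun y hy => h (u x) y (u.norm_coe_le_norm x) (by simpa [dist_eq_norm] using hy))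
    (Metric.mem_closedBall_self hδ.le) (by simpa [dist_eq_norm] using hvx)
  refine key.trans ?_
  gcongr
  exact (v - u).norm_coe_le_norm x

/-- The class `C^k` case, by induction on `k`; the target `G` varies in the induction, since the
derivative of `u ↦ F ∘ u` is expressed by the superposition operator of `fderiv ℝ F`. -/
theorem contDiff_nat_superposition (k : ℕ) :
    ∀ {G : Type} [NormedAddCommGroup G] [NormedSpace ℝ G] {F : E → G} (hF : ContDiff ℝ k F),
      ContDiff ℝ k (superposition X F hF.continuous) := by
  induction k with
  | zero =>
    intro G _ _ F hF
    exact contDiff_zero.2 (continuous_superposition F hF.continuous)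
  | succ k ih =>
    intro G _ _ F hF
    have h1 : ContDiff ℝ 1 F := hF.of_le (by norm_cast; omega)
    have hd : ContDiff ℝ k (fderiv ℝ F) := hF.fderiv_right (by norm_cast)
    have hfd : fderiv ℝ (superposition X F hF.continuous) =
        fun u => pointwiseApply X E G (superposition X (fderiv ℝ F) hd.continuous u) :=
      funext fun u => (hasFDerivAt_superposition h1 u).fderiv
    suffices h : ContDiff ℝ ((k : WithTop ℕ∞) + 1) (superposition X F hF.continuous) by
      exact_mod_cast h
    refine contDiff_succ_iff_fderiv.2
      ⟨fun u => (hasFDerivAt_superposition h1 u).differentiableAt, by simp, ?_⟩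
    rw [hfd]
    exact (pointwiseApply X E G).contDiff.comp (ih hd)

/-- The superposition operator of a smooth map is smooth. -/
theorem contDiff_superposition {F : E → G} (hF : ContDiff ℝ ∞ F) :
    ContDiff ℝ ∞ (superposition X F hF.continuous) :=
  contDiff_infty.2 fun k => contDiff_nat_superposition k (hF.of_le (by exact_mod_cast le_top))

end Superposition

/-! ### The smooth inverse function theorem, and extension of smooth germs -/

/-- The inverse function theorem for a smooth map, with a local inverse that is smooth on its whole
domain and not just at the image of `a`. -/
theorem exists_openPartialHomeomorph_contDiffOn {E F : Type} [NormedAddCommGroup E]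
    [NormedSpace ℝ E] [CompleteSpace E] [NormedAddCommGroup F] [NormedSpace ℝ F]
    {f : E → F} {U : Set E} (hU : IsOpen U) (hf : ContDiffOn ℝ ∞ f U) {a : E} (ha : a ∈ U)
    (A : E ≃L[ℝ] F) (hA : HasFDerivAt f (A : E →L[ℝ] F) a) :
    ∃ e : OpenPartialHomeomorph E F, a ∈ e.source ∧ e.source ⊆ U ∧ (∀ y, e y = f y) ∧
      ContDiffOn ℝ ∞ e e.source ∧ ContDiffOn ℝ ∞ e.symm e.target := by
  have hfa : ContDiffAt ℝ ∞ f a := hf.contDiffAt (hU.mem_nhds ha)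
  let e₀ := hfa.toOpenPartialHomeomorph f hA (by simp)
  have hcont : ContinuousOn (fderiv ℝ f) U := hf.continuousOn_fderiv_of_isOpen hU (by simp)
  -- the open set on which the derivative stays invertible
  let V : Set E := U ∩ fderiv ℝ f ⁻¹' range ((↑) : (E ≃L[ℝ] F) → E →L[ℝ] F)
  have hV : IsOpen V := hcont.isOpen_inter_preimage hU (ContinuousLinearEquiv.isOpen)
  have haV : a ∈ V := ⟨ha, A, hA.fderiv.symm⟩
  refine ⟨e₀.restrOpen V hV, ⟨hfa.mem_toOpenPartialHomeomorph_source hA _, haV⟩,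
    fun y hy => hy.2.1, fun y => rfl, fun y hy => ?_, fun z hz => ?_⟩
  · exact ((hf.contDiffAt (hU.mem_nhds hy.2.1)).contDiffWithinAt :)
  · have hy := (e₀.restrOpen V hV).map_target hz
    obtain ⟨B, hB⟩ := hy.2.2
    have hsm : ContDiffAt ℝ ∞ f ((e₀.restrOpen V hV).symm z) :=
      hf.contDiffAt (hU.mem_nhds hy.2.1)
    refine ((e₀.restrOpen V hV).contDiffAt_symm hz (f₀' := B) ?_ hsm).contDiffWithinAt
    rw [hB]
    exact (hsm.differentiableAt (by simp)).hasFDerivAt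

/-- Multiplication by a bump function extends a smooth germ to a smooth function on the whole
space. -/
theorem exists_contDiff_eventuallyEq {E F : Type} [NormedAddCommGroup E] [NormedSpace ℝ E]
    [FiniteDimensional ℝ E] [NormedAddCommGroup F] [NormedSpace ℝ F]
    {f : E → F} {U : Set E} (hf : ContDiffOn ℝ ∞ f U) {a : E} (hU : U ∈ 𝓝 a) :
    ∃ g : E → F, ContDiff ℝ ∞ g ∧ g =ᶠ[𝓝 a] f := by
  obtain ⟨r, hr, hrU⟩ := Metric.mem_nhds_iff.1 hU
  let χ : ContDiffBump a := ⟨r / 3, r / 2, by positivity, by linarith⟩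
  refine ⟨fun y => χ y • f y, ?_, ?_⟩
  · rw [contDiff_iff_contDiffAt]
    intro y
    by_cases hy : y ∈ Metric.ball a r
    · exact χ.contDiffAt.smul (hf.contDiffAt (mem_of_superset (Metric.isOpen_ball.mem_nhds hy) hrU))
    · have : (fun y => χ y • f y) =ᶠ[𝓝 y] fun _ => 0 := by
        have h0 : (Metric.closedBall a (r / 2))ᶜ ∈ 𝓝 y := by
          refine Metric.isClosed_closedBall.isOpen_compl.mem_nhds ?_
          simp only [Metric.mem_ball, not_lt, mem_compl_iff, Metric.mem_closedBall, not_le] at hy ⊢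
          linarith
        filter_upwards [h0] with z hz
        have : χ z = 0 := χ.zero_of_le_dist (by
          simp only [mem_compl_iff, Metric.mem_closedBall, not_le] at hz; exact hz.le)
        rw [this, zero_smul]
      exact contDiffAt_const.congr_of_eventuallyEq this
  · filter_upwards [χ.eventuallyEq_one] with y hy
    rw [hy]; simp

/-! ### Smooth local flows -/

section LocalFlow

variable {E : Type} [NormedAddCommGroup E]

/-! Functions on `[-1, 1]` are extended to the real line by constants, which makes their interval
integrals available. -/

theorem continuous_extend_Icc (u : Icc (-1 : ℝ) 1 →ᵇ E) :
    Continuous (fun r => u (projIcc (-1 : ℝ) 1 (by norm_num) r)) :=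
  u.continuous.comp continuous_projIcc

variable [NormedSpace ℝ E]

theorem continuous_integral_extend_Icc (u : Icc (-1 : ℝ) 1 →ᵇ E) :
    Continuous (fun s => ∫ r in (0 : ℝ)..s, u (projIcc (-1 : ℝ) 1 (by norm_num) r)) :=
  intervalIntegral.continuous_primitive
    (fun _ _ => (continuous_extend_Icc u).intervalIntegrable _ _) 0

theorem norm_integral_extend_Icc_le (u : Icc (-1 : ℝ) 1 →ᵇ E) (s : Icc (-1 : ℝ) 1) :
    ‖∫ r in (0 : ℝ)..s, u (projIcc (-1 : ℝ) 1 (by norm_num) r)‖ ≤ ‖u‖ := by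
  refine (intervalIntegral.norm_integral_le_of_norm_le_const (C := ‖u‖)
    fun r _ => u.norm_coe_le_norm _).trans ?_
  rw [sub_zero]
  exact mul_le_of_le_one_right (norm_nonneg _) (abs_le.2 s.2)

variable (E) in
/-- The operator taking a function on `[-1, 1]` to its primitive vanishing at `0`. -/
noncomputable def primitive : (Icc (-1 : ℝ) 1 →ᵇ E) →L[ℝ] (Icc (-1 : ℝ) 1 →ᵇ E) :=
  LinearMap.mkContinuous
    { toFun := fun u => BoundedContinuousFunction.ofNormedAddCommGroup
        (fun s => ∫ r in (0 : ℝ)..s, u (projIcc (-1 : ℝ) 1 (by norm_num) r))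
        ((continuous_integral_extend_Icc u).comp continuous_subtype_val)
        ‖u‖ (norm_integral_extend_Icc_le u)
      map_add' := fun u v => by
        ext s
        simp only [coe_ofNormedAddCommGroup, BoundedContinuousFunction.add_apply]
        exact intervalIntegral.integral_add ((continuous_extend_Icc u).intervalIntegrable _ _)
          ((continuous_extend_Icc v).intervalIntegrable _ _)
      map_smul' := fun c u => by
        ext s
        simp only [coe_ofNormedAddCommGroup, BoundedContinuousFunction.smul_apply, RingHom.id_apply]
        exact intervalIntegral.integral_smul c _ }
    1 (fun u => by
      rw [one_mul]
      exact (BoundedContinuousFunction.norm_le (norm_nonneg u)).2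
        (norm_integral_extend_Icc_le u))

theorem primitive_apply (u : Icc (-1 : ℝ) 1 →ᵇ E) (s : Icc (-1 : ℝ) 1) :
    primitive E u s = ∫ r in (0 : ℝ)..s, u (projIcc (-1 : ℝ) 1 (by norm_num) r) := rfl

theorem hasFDerivAt_apply {X : Type} [TopologicalSpace X] {u : E → (X →ᵇ E)}
    {u' : E →L[ℝ] (X →ᵇ E)} {y : E} (h : HasFDerivAt u u' y) (s : X) :
    HasFDerivAt (fun y => u y s) ((evalCLM ℝ s).comp u') y :=
  (evalCLM ℝ s : (X →ᵇ E) →L[ℝ] E).hasFDerivAt.comp y h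

variable [CompleteSpace E]

/-- A solution of the rescaled integral equation `u = y + T ∫ w` on `[-1, 1]` gives, after undoing
the rescaling, a differentiable function on `(-T, T)`. -/
theorem hasDerivAt_of_eq_add_primitive {u w : Icc (-1 : ℝ) 1 →ᵇ E} {y : E} {T : ℝ} (hT : 0 < T)
    (h : ∀ s, u s = y + T • primitive E w s) {t : ℝ} (ht : t ∈ Ioo (-T) T) :
    HasDerivAt (fun t => u (projIcc (-1 : ℝ) 1 (by norm_num) (t / T)))
      (w (projIcc (-1 : ℝ) 1 (by norm_num) (t / T))) t := by
  have h1 : HasDerivAt (fun s => ∫ r in (0 : ℝ)..s, w (projIcc (-1 : ℝ) 1 (by norm_num) r))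
      (w (projIcc (-1 : ℝ) 1 (by norm_num) (t / T))) (t / T) :=
    (continuous_extend_Icc w).integral_hasStrictDerivAt 0 (t / T) |>.hasDerivAt
  have h2 := ((h1.scomp t ((hasDerivAt_id t).div_const T)).const_smul T).const_add y
  have h3 : T • ((1 / T) • w (projIcc (-1 : ℝ) 1 (by norm_num) (t / T))) =
      w (projIcc (-1 : ℝ) 1 (by norm_num) (t / T)) := by
    rw [smul_smul, mul_one_div_cancel hT.ne', one_smul]
  rw [h3] at h2
  refine h2.congr_of_eventuallyEq ?_
  filter_upwards [Ioo_mem_nhds ht.1 ht.2] with s hs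
  have hs' : s / T ∈ Icc (-1 : ℝ) 1 := by
    constructor
    · rw [le_div_iff₀ hT]; linarith [hs.1]
    · rw [div_le_iff₀ hT]; linarith [hs.2]
  rw [h, primitive_apply, projIcc_of_mem _ hs']
  rfl

variable [FiniteDimensional ℝ E]

/-- The solutions of the rescaled integral equation `u = y + T ∫ F ∘ u` on `[-1, 1]` near a point,
as a smooth function of the initial value `y`. For `T = 0` the linearization of the equation in
`u` is the identity, so the inverse function theorem applies for small `T`. -/
theorem exists_smooth_solution {F : E → E} (hF : ContDiff ℝ ∞ F) (y₀ : E) {U : Set E}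
    (hU : U ∈ 𝓝 y₀) :
    ∃ T > (0 : ℝ), ∃ V, IsOpen V ∧ y₀ ∈ V ∧ ∃ u : E → (Icc (-1 : ℝ) 1 →ᵇ E), ContDiffOn ℝ ∞ u V ∧
      (∀ y ∈ V, ∀ s, u y s ∈ U) ∧
      (∀ y ∈ V, u y = const _ y + T • primitive E (superposition _ F hF.continuous (u y))) ∧
      (F y₀ = 0 → u y₀ = const _ y₀) := by
  set N := superposition (Icc (-1 : ℝ) 1) F hF.continuous with hN
  have hNs : ContDiff ℝ ∞ N := contDiff_superposition hF
  obtain ⟨r, hr, hrU⟩ := Metric.mem_nhds_iff.1 hU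
  let Ψ : ℝ × (Icc (-1 : ℝ) 1 →ᵇ E) → ℝ × (Icc (-1 : ℝ) 1 →ᵇ E) :=
    fun p => (p.1, p.2 - p.1 • primitive E (N p.2))
  have hsnd : ContDiff ℝ ∞ (fun p : ℝ × (Icc (-1 : ℝ) 1 →ᵇ E) => primitive E (N p.2)) :=
    (primitive E).contDiff.comp (hNs.comp contDiff_snd)
  have hΨ : ContDiff ℝ ∞ Ψ :=
    contDiff_fst.prodMk (contDiff_snd.sub (contDiff_fst.smul hsnd))
  let c₀ : Icc (-1 : ℝ) 1 →ᵇ E := const _ y₀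
  let w := primitive E (N c₀)
  let f₁ := ContinuousLinearMap.fst ℝ ℝ (Icc (-1 : ℝ) 1 →ᵇ E)
  let f₂ := ContinuousLinearMap.snd ℝ ℝ (Icc (-1 : ℝ) 1 →ᵇ E)
  let A : (ℝ × (Icc (-1 : ℝ) 1 →ᵇ E)) ≃L[ℝ] (ℝ × (Icc (-1 : ℝ) 1 →ᵇ E)) :=
    ContinuousLinearEquiv.equivOfInverse (f₁.prod (f₂ - f₁.smulRight w))
      (f₁.prod (f₂ + f₁.smulRight w))
      (fun p => by ext <;> simp [f₁, f₂]) (fun p => by ext <;> simp [f₁, f₂])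
  have hA : HasFDerivAt Ψ (A : (ℝ × (Icc (-1 : ℝ) 1 →ᵇ E)) →L[ℝ] _) (0, c₀) := by
    have h1 := (hasFDerivAt_fst (𝕜 := ℝ) (p := ((0 : ℝ), c₀))).smul
      ((hsnd.differentiable (by simp) ((0 : ℝ), c₀)).hasFDerivAt)
    have h2 := (hasFDerivAt_fst (𝕜 := ℝ) (p := ((0 : ℝ), c₀))).prodMk
      ((hasFDerivAt_snd (𝕜 := ℝ) (p := ((0 : ℝ), c₀))).sub h1)
    refine h2.congr_fderiv ?_
    rw [zero_smul, zero_add]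
    rfl
  have hUo : IsOpen (Prod.snd ⁻¹' Metric.ball c₀ r : Set (ℝ × (Icc (-1 : ℝ) 1 →ᵇ E))) :=
    Metric.isOpen_ball.preimage continuous_snd
  obtain ⟨e, he0, heU, he, -, hesymm⟩ := exists_openPartialHomeomorph_contDiffOn hUo hΨ.contDiffOn
    (a := (0, c₀)) (by simpa using hr) A hA
  have hΨ0 : Ψ (0, c₀) = (0, c₀) := by simp [Ψ]
  have ht0 : ((0 : ℝ), c₀) ∈ e.target := by
    have := e.map_source he0
    rwa [he, hΨ0] at this
  -- the constant functions, as a continuous linear map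
  let K : E →L[ℝ] (Icc (-1 : ℝ) 1 →ᵇ E) :=
    LinearMap.mkContinuous
      { toFun := fun y => const _ y
        map_add' := fun _ _ => rfl
        map_smul' := fun _ _ => rfl } 1 (fun y => by rw [one_mul]; exact norm_const_le y)
  have hcs : ContinuousAt (fun T : ℝ => (T, c₀)) 0 := by fun_prop
  have hev : ∀ᶠ T in 𝓝 (0 : ℝ), (T, c₀) ∈ e.target ∧ (T, c₀) ∈ e.source :=
    (hcs.eventually (e.open_target.mem_nhds ht0)).and (hcs.eventually (e.open_source.mem_nhds he0))
  obtain ⟨T, ⟨hTt, hTs⟩, hT⟩ :=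
    ((hev.filter_mono nhdsWithin_le_nhds).and (self_mem_nhdsWithin (s := Ioi (0 : ℝ)))).exists
  have hKT : ContDiff ℝ ∞ (fun y => (T, K y)) := contDiff_const.prodMk K.contDiff
  refine ⟨T, hT, (fun y => (T, K y)) ⁻¹' e.target, e.open_target.preimage hKT.continuous, hTt,
    fun y => (e.symm (T, K y)).2, ?_, ?_, ?_, ?_⟩
  · exact contDiff_snd.comp_contDiffOn (hesymm.comp hKT.contDiffOn fun y hy => hy)
  · intro y hy s
    have h1 := heU (e.map_target hy)
    have h2 : dist ((e.symm (T, K y)).2 s) (c₀ s) < r :=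
      (BoundedContinuousFunction.dist_coe_le_dist s).trans_lt h1
    exact hrU h2
  · intro y hy
    have h1 : Ψ (e.symm (T, K y)) = (T, K y) := by rw [← he]; exact e.right_inv hy
    have h2 : (e.symm (T, K y)).1 = T := congrArg Prod.fst h1
    have h3 := congrArg Prod.snd h1
    simp only [Ψ, h2] at h3
    exact sub_eq_iff_eq_add.1 h3
  · intro h0
    have hN0 : N c₀ = 0 := by ext s; exact h0
    have h1 : e (T, c₀) = (T, c₀) := by rw [he]; simp [Ψ, hN0]
    have h2 : e.symm (T, c₀) = (T, c₀) := by
      conv_lhs => rw [← h1]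
      exact e.left_inv hTs
    exact congrArg Prod.snd h2

/-- Near every point, a smooth vector field has a local flow that is smooth in the initial value;
at a zero of the field, its derivative has the eigenvectors of the linearized field as
eigenvectors. -/
theorem exists_smooth_local_flow {F : E → E} (hF : ContDiff ℝ ∞ F) (y₀ : E) {U : Set E}
    (hU : U ∈ 𝓝 y₀) :
    ∃ T > (0 : ℝ), ∃ V, IsOpen V ∧ y₀ ∈ V ∧ ∃ Φ : ℝ → E → E,
      (∀ t, ContDiffOn ℝ ∞ (Φ t) V) ∧
      ContinuousOn (fun p : ℝ × E => Φ p.1 p.2) (univ ×ˢ V) ∧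
      (∀ y ∈ V, Φ 0 y = y) ∧ (∀ y ∈ V, ∀ t, Φ t y ∈ U) ∧
      (∀ y ∈ V, ∀ t ∈ Ioo (-T) T, HasDerivAt (fun s => Φ s y) (F (Φ t y)) t) ∧
      (F y₀ = 0 → ∀ (μ : ℝ) (v : E), fderiv ℝ F y₀ v = μ • v →
        ∀ t ∈ Ioo (-T) T, fderiv ℝ (Φ t) y₀ v = Real.exp (μ * t) • v) := by
  obtain ⟨T, hT, V, hVo, hV, u, hu, huU, hueq, hu0⟩ := exists_smooth_solution hF y₀ hU
  have hs : ∀ y ∈ V, ∀ s,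
      u y s = y + T • primitive E (superposition _ F hF.continuous (u y)) s := by
    intro y hy s
    conv_lhs => rw [hueq y hy]
    rfl
  have hproj0 : ((projIcc (-1 : ℝ) 1 (by norm_num) (0 / T) : Icc (-1 : ℝ) 1) : ℝ) = 0 := by
    rw [zero_div, projIcc_of_mem _ (by norm_num : (0 : ℝ) ∈ Icc (-1 : ℝ) 1)]
  refine ⟨T, hT, V, hVo, hV, fun t y => u y (projIcc (-1 : ℝ) 1 (by norm_num) (t / T)),
    fun t => ?_, ?_, ?_, fun y hy t => huU y hy _,
    fun y hy t ht => hasDerivAt_of_eq_add_primitive hT (hs y hy) ht, ?_⟩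
  · exact (evalCLM ℝ _).contDiff.comp_contDiffOn hu
  · have h1 : ContinuousOn (fun p : ℝ × E => (u p.2, projIcc (-1 : ℝ) 1 (by norm_num) (p.1 / T)))
        (univ ×ˢ V) := by
      refine ContinuousOn.prodMk (hu.continuousOn.comp continuousOn_snd fun p hp => hp.2) ?_
      exact (continuous_projIcc.comp (continuous_fst.div_const T)).continuousOn
    exact (continuous_eval (F := (Icc (-1 : ℝ) 1 →ᵇ E))).comp_continuousOn h1
  · intro y hy
    simp only
    rw [hs y hy, primitive_apply, hproj0, intervalIntegral.integral_same, smul_zero, add_zero]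
  · intro h0 μ v hv t ht
    have hc := hu0 h0
    have hud : HasFDerivAt u (fderiv ℝ u y₀) y₀ :=
      ((hu.contDiffAt (hVo.mem_nhds hV)).differentiableAt (by simp)).hasFDerivAt
    set h := fderiv ℝ u y₀ v with hh
    have hΦ : ∀ t, HasFDerivAt (fun y => u y (projIcc (-1 : ℝ) 1 (by norm_num) (t / T)))
        ((evalCLM ℝ (projIcc (-1 : ℝ) 1 (by norm_num) (t / T))).comp (fderiv ℝ u y₀)) y₀ :=
      fun t => hasFDerivAt_apply hud _
    rw [(hΦ t).fderiv]
    change h (projIcc (-1 : ℝ) 1 (by norm_num) (t / T)) = _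
    -- the derivative of the integral equation with respect to the initial value
    have hlin : ∀ s,
        h s = v + T • primitive E ((fderiv ℝ F y₀).compLeftContinuousBounded _ h) s := by
      have hN := hasFDerivAt_superposition (X := Icc (-1 : ℝ) 1) (hF.of_le (by simp)) (u y₀)
      have h1 := ((primitive E).hasFDerivAt.comp y₀ (hN.comp y₀ hud)).const_smul T
      intro s
      have h2 := (hasFDerivAt_id (𝕜 := ℝ) y₀).add (hasFDerivAt_apply h1 s)
      have h3 : HasFDerivAt (fun y => u y s) ((evalCLM ℝ s).comp (fderiv ℝ u y₀)) y₀ :=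
        hasFDerivAt_apply hud s
      have h4 := h3.unique (h2.congr_of_eventuallyEq
        (by filter_upwards [hVo.mem_nhds hV] with y hy using hs y hy s))
      have h5 := DFunLike.congr_fun h4 v
      refine h5.trans ?_
      change v + T • primitive E _ s = _
      congr 4
      ext r
      change fderiv ℝ F (u y₀ r) (h r) = _
      rw [hc]; rfl
    have hder : ∀ t ∈ Ioo (-T) T, HasDerivAt (fun t => h (projIcc (-1 : ℝ) 1 (by norm_num) (t / T)))
        (fderiv ℝ F y₀ (h (projIcc (-1 : ℝ) 1 (by norm_num) (t / T)))) t :=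
      fun t ht => hasDerivAt_of_eq_add_primitive hT hlin ht
    have hexp : ∀ t ∈ Ioo (-T) T, HasDerivAt (fun t => Real.exp (μ * t) • v)
        (fderiv ℝ F y₀ (Real.exp (μ * t) • v)) t := by
      intro t _
      have := (((hasDerivAt_id t).const_mul μ).exp).smul_const v
      rw [map_smul, hv, smul_smul]
      simpa using this
    refine ODE_solution_unique_of_mem_Ioo (v := fun _ => fderiv ℝ F y₀) (s := fun _ => univ)
      (K := ‖fderiv ℝ F y₀‖₊) (t₀ := 0) (a := -T) (b := T)
      (fun t _ => (fderiv ℝ F y₀).lipschitz.lipschitzOnWith) (by constructor <;> linarith)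
      (fun t ht => ⟨hder t ht, mem_univ _⟩) (fun t ht => ⟨hexp t ht, mem_univ _⟩) ?_ ht
    rw [hlin, primitive_apply, hproj0, intervalIntegral.integral_same]
    simp

end LocalFlow

/-! ### The local stable manifold of a hyperbolic fixed point -/

section Scalar

/-- In a contracting direction, the recursion `c (k + 1) = β c k + γ k` with bounded `γ` has a
bounded solution for every initial value. -/
theorem exists_bounded_solution_of_lt_one {β : ℝ} (hβ : 0 < β) (hβ1 : β < 1) (a : ℝ) {γ : ℕ → ℝ}
    {C : ℝ} (hC : ∀ k, |γ k| ≤ C) :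
    ∃ c : ℕ → ℝ, (∀ k, c (k + 1) = β * c k + γ k) ∧ (∃ D, ∀ k, |c k| ≤ D) ∧ c 0 = a := by
  let c : ℕ → ℝ := fun k => Nat.rec a (fun k x => β * x + γ k) k
  have hC0 : 0 ≤ C := (abs_nonneg _).trans (hC 0)
  have h1 : 0 < 1 - β := by linarith
  refine ⟨c, fun k => rfl, ⟨|a| + C / (1 - β), fun k => ?_⟩, rfl⟩
  induction k with
  | zero => change |a| ≤ _; have : 0 ≤ C / (1 - β) := by positivity
            linarith
  | succ k ih =>
    have h2 : |c (k + 1)| ≤ β * |c k| + |γ k| := by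
      refine (abs_add_le (β * c k) (γ k)).trans ?_
      rw [abs_mul, abs_of_pos hβ]
    have h3 : β * (|a| + C / (1 - β)) + C = β * |a| + C / (1 - β) := by field_simp; ring
    nlinarith [mul_le_mul_of_nonneg_left ih hβ.le, hC k, abs_nonneg a]

/-- In an expanding direction, the recursion `c (k + 1) = β c k + γ k` with bounded `γ` is solved
backwards from infinity: `c k = -∑ⱼ β^(-j-1) γ (k + j)`. -/
theorem exists_bounded_solution_of_one_lt {β : ℝ} (hβ1 : 1 < β) {γ : ℕ → ℝ}
    {C : ℝ} (hC : ∀ k, |γ k| ≤ C) :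
    ∃ c : ℕ → ℝ, (∀ k, c (k + 1) = β * c k + γ k) ∧ ∃ D, ∀ k, |c k| ≤ D := by
  have hβ : 0 < β := by linarith
  have hg : Summable fun j : ℕ => (β⁻¹) ^ (j + 1) * C :=
    ((summable_nat_add_iff 1).2 (summable_geometric_of_lt_one (by positivity)
      (inv_lt_one_of_one_lt₀ hβ1))).mul_right C
  have hle : ∀ k j, ‖(β⁻¹) ^ (j + 1) * γ (k + j)‖ ≤ (β⁻¹) ^ (j + 1) * C := by
    intro k j
    rw [norm_mul, norm_pow, norm_inv, Real.norm_of_nonneg hβ.le]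
    exact mul_le_mul_of_nonneg_left (hC _) (by positivity)
  have hs : ∀ k, Summable fun j : ℕ => (β⁻¹) ^ (j + 1) * γ (k + j) :=
    fun k => Summable.of_norm_bounded hg (hle k)
  refine ⟨fun k => -∑' j : ℕ, (β⁻¹) ^ (j + 1) * γ (k + j), fun k => ?_,
    ∑' j : ℕ, (β⁻¹) ^ (j + 1) * C, fun k => ?_⟩
  · beta_reduce
    rw [(hs k).tsum_eq_zero_add]
    have : ∀ j : ℕ, (β⁻¹) ^ (j + 1 + 1) * γ (k + (j + 1)) =
        β⁻¹ * ((β⁻¹) ^ (j + 1) * γ (k + 1 + j)) := by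
      intro j
      rw [show k + (j + 1) = k + 1 + j by ring]; ring
    simp only [this, tsum_mul_left]
    rw [add_zero, zero_add, pow_one, mul_neg, mul_add, mul_inv_cancel_left₀ hβ.ne',
      mul_inv_cancel_left₀ hβ.ne']
    ring
  · rw [abs_neg]
    exact tsum_of_norm_bounded hg.hasSum (hle k)

end Scalar

/-! Throughout, `B` is diagonal in the basis `b` with eigenvalues `β i`, and `P` is the projection
to the span of the `b i` with `β i < 1` along the other basis vectors. -/

section LocalStable

variable {E : Type} [NormedAddCommGroup E] [NormedSpace ℝ E]
  {ι : Type} {b : Module.Basis ι ℝ E} {β : ι → ℝ} {B P : E →L[ℝ] E}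

theorem coord_map_of_eigenbasis (hB : ∀ i, B (b i) = β i • b i) (i : ι) (x : E) :
    b.repr (B x) i = β i * b.repr x i := by
  have h : (b.coord i).comp (B : E →ₗ[ℝ] E) = β i • b.coord i := by
    refine b.ext fun j => ?_
    simp only [LinearMap.comp_apply, ContinuousLinearMap.coe_coe, hB, map_smul,
      LinearMap.smul_apply, Module.Basis.coord_apply, Module.Basis.repr_self]
    by_cases hij : j = i
    · rw [hij]
    · simp [hij]
  exact LinearMap.congr_fun h x

theorem coord_stableProjection (hP : ∀ i, P (b i) = if β i < 1 then b i else 0) (i : ι) (x : E) :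
    b.repr (P x) i = if β i < 1 then b.repr x i else 0 := by
  have := coord_map_of_eigenbasis (b := b) (B := P) (β := fun i => if β i < 1 then 1 else 0)
    (fun i => by rw [hP]; split_ifs <;> simp) i x
  rw [this]; split_ifs <;> simp

theorem stableProjection_idem (hP : ∀ i, P (b i) = if β i < 1 then b i else 0) (x : E) :
    P (P x) = P x := by
  refine b.ext_elem fun i => ?_
  rw [coord_stableProjection hP, coord_stableProjection hP]
  split_ifs <;> rfl

variable [FiniteDimensional ℝ E]

theorem exists_abs_repr_le (b : Module.Basis ι ℝ E) (i : ι) (u : ℕ →ᵇ E) :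
    ∃ C, ∀ k, |b.repr (u k) i| ≤ C := by
  let l : E →L[ℝ] ℝ := LinearMap.toContinuousLinearMap (b.coord i)
  exact ⟨‖l‖ * ‖u‖, fun k => (l.le_opNorm (u k)).trans
    (mul_le_mul_of_nonneg_left (u.norm_coe_le_norm k) (norm_nonneg _))⟩

/-- A bounded forward orbit of a hyperbolic linear map starts in the stable subspace. -/
theorem stableProjection_of_bounded_orbit (hβ : ∀ i, 0 < β i) (hβ1 : ∀ i, β i ≠ 1)
    (hB : ∀ i, B (b i) = β i • b i) (hP : ∀ i, P (b i) = if β i < 1 then b i else 0)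
    (u : ℕ →ᵇ E) (hu : ∀ k, u (k + 1) = B (u k)) : P (u 0) = u 0 := by
  refine b.ext_elem fun i => ?_
  rw [coord_stableProjection hP]
  split_ifs with h
  · rfl
  · have h1 : 1 < β i := lt_of_le_of_ne (not_lt.1 h) (hβ1 i).symm
    obtain ⟨C, hC⟩ := exists_abs_repr_le b i u
    have hk : ∀ k, b.repr (u k) i = β i ^ k * b.repr (u 0) i := by
      intro k
      induction k with
      | zero => simp
      | succ k ih => rw [hu, coord_map_of_eigenbasis hB, ih]; ring
    by_contra hne
    have hpos : 0 < |b.repr (u 0) i| := abs_pos.2 (Ne.symm hne)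
    obtain ⟨k, hk'⟩ := pow_unbounded_of_one_lt (C / |b.repr (u 0) i|) h1
    have h2 := hC k
    rw [hk, abs_mul, abs_of_pos (pow_pos (hβ i) k)] at h2
    rw [div_lt_iff₀ hpos] at hk'
    linarith

variable [Fintype ι]

/-- The linearization of Irwin's map `u ↦ (P (u 0), (u (k + 1) - φ (u k))ₖ)` is surjective on
bounded sequences. -/
theorem exists_bounded_linear_solution (hβ : ∀ i, 0 < β i) (hβ1 : ∀ i, β i ≠ 1)
    (hB : ∀ i, B (b i) = β i • b i) (hP : ∀ i, P (b i) = if β i < 1 then b i else 0)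
    (x : E) (g : ℕ →ᵇ E) :
    ∃ u : ℕ →ᵇ E, (∀ k, u (k + 1) - B (u k) = g k) ∧ P (u 0) = P x := by
  have hsc : ∀ i, ∃ c : ℕ → ℝ, (∀ k, c (k + 1) = β i * c k + b.repr (g k) i) ∧
      (∃ D, ∀ k, |c k| ≤ D) ∧ (β i < 1 → c 0 = b.repr x i) := by
    intro i
    obtain ⟨C, hC⟩ := exists_abs_repr_le b i g
    rcases lt_or_gt_of_ne (hβ1 i) with h | h
    · obtain ⟨c, h1, h2, h3⟩ := exists_bounded_solution_of_lt_one (hβ i) h (b.repr x i) hC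
      exact ⟨c, h1, h2, fun _ => h3⟩
    · obtain ⟨c, h1, h2⟩ := exists_bounded_solution_of_one_lt h hC
      exact ⟨c, h1, h2, fun h' => absurd h' h.not_gt⟩
  choose c hc hD hc0 using hsc
  choose D hD using hD
  let u : ℕ →ᵇ E := BoundedContinuousFunction.ofNormedAddCommGroupDiscrete
    (fun k => ∑ i, c i k • b i) (∑ i, D i * ‖b i‖) fun k => by
      refine (norm_sum_le _ _).trans (Finset.sum_le_sum fun i _ => ?_)
      rw [norm_smul]
      exact mul_le_mul_of_nonneg_right (hD i k) (norm_nonneg _)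
  have hu : ∀ k i, b.repr (u k) i = c i k := fun k i => by
    change b.repr (∑ i, c i k • b i) i = c i k
    rw [b.repr_sum_self]
  refine ⟨u, fun k => b.ext_elem fun i => ?_, b.ext_elem fun i => ?_⟩
  · rw [map_sub, Finsupp.sub_apply, coord_map_of_eigenbasis hB, hu, hu, hc]; ring
  · rw [coord_stableProjection hP, coord_stableProjection hP, hu]
    split_ifs with h
    · exact hc0 i h
    · rfl

/-- The forward orbits of `φ` near a hyperbolic fixed point: after a change of coordinates `H`
tangent to the identity, the points whose orbits stay near the fixed point form the stable subspace
(the range of `P`). The orbits are found, following Irwin, by applying the inverse function theorem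
to `u ↦ (P (u 0), (u (k + 1) - φ (u k))ₖ)` on the space of bounded sequences. -/
theorem exists_stable_straightening {φ : E → E} (hφ : ContDiff ℝ ∞ φ) (hφ0 : φ 0 = 0)
    (hφB : fderiv ℝ φ 0 = B) (hβ : ∀ i, 0 < β i) (hβ1 : ∀ i, β i ≠ 1)
    (hB : ∀ i, B (b i) = β i • b i) (hP : ∀ i, P (b i) = if β i < 1 then b i else 0) :
    ∃ (H : E → E) (U : Set E), IsOpen U ∧ (0 : E) ∈ U ∧ ContDiffOn ℝ ∞ H U ∧ H 0 = 0 ∧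
      HasFDerivAt H (ContinuousLinearMap.id ℝ E) 0 ∧
      (∃ δ > 0, ∀ y, (∀ k, ‖φ^[k] y‖ ≤ δ) → P (H y) = H y) ∧
      (∀ δ > 0, ∀ᶠ y in 𝓝 0, P (H y) = H y → ∀ k, ‖φ^[k] y‖ < δ) := by
  let S : Submodule ℝ E := LinearMap.range (P : E →ₗ[ℝ] E)
  let PS : E →L[ℝ] S := P.codRestrict S fun x => ⟨x, rfl⟩
  have hPS : ∀ x, (PS x : E) = P x := fun x => rfl
  set N := superposition ℕ φ hφ.continuous with hN
  have hNs : ContDiff ℝ ∞ N := contDiff_superposition hφ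
  let sh : (ℕ →ᵇ E) →L[ℝ] (ℕ →ᵇ E) :=
    compContinuousCLM E ℝ (⟨fun k => k + 1, continuous_of_discreteTopology⟩ : C(ℕ, ℕ))
  have hsh : ∀ (u : ℕ →ᵇ E) k, sh u k = u (k + 1) := fun u k => rfl
  let ev : (ℕ →ᵇ E) →L[ℝ] E := evalCLM ℝ 0
  have hev : ∀ u : ℕ →ᵇ E, ev u = u 0 := fun u => rfl
  let Ψ : (ℕ →ᵇ E) → S × (ℕ →ᵇ E) := fun u => (PS (ev u), sh u - N u)
  have hΨ : ContDiff ℝ ∞ Ψ :=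
    ((PS.comp ev).contDiff).prodMk (sh.contDiff.sub hNs)
  have hΨ0 : Ψ 0 = 0 := by
    refine Prod.ext (by simp [Ψ]) ?_
    ext k
    change (0 : E) - φ 0 = 0
    rw [hφ0, sub_zero]
  -- the linearization of `Ψ` at `0`
  let Λ : (ℕ →ᵇ E) →L[ℝ] S × (ℕ →ᵇ E) :=
    (PS.comp ev).prod (sh - B.compLeftContinuousBounded ℕ)
  have hΛ1 : ∀ u, (Λ u).1 = PS (u 0) := fun u => rfl
  have hΛ2 : ∀ u k, (Λ u).2 k = u (k + 1) - B (u k) := fun u k => rfl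
  have hΛ : HasFDerivAt Ψ Λ 0 := by
    have h1 := hasFDerivAt_superposition (X := ℕ) (hφ.of_le (by simp)) (0 : ℕ →ᵇ E)
    have h2 := ((PS.comp ev).hasFDerivAt (x := 0)).prodMk ((sh.hasFDerivAt (x := 0)).sub h1)
    refine h2.congr_fderiv ?_
    refine ContinuousLinearMap.ext fun u => Prod.ext rfl ?_
    ext k
    change u (k + 1) - fderiv ℝ φ 0 (u k) = u (k + 1) - B (u k)
    rw [hφB]
  have horb : ∀ u : ℕ →ᵇ E, (Λ u).2 = 0 → P (u 0) = u 0 := fun u hu =>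
    stableProjection_of_bounded_orbit hβ hβ1 hB hP u fun k => by
      rw [← sub_eq_zero, ← hΛ2, hu]; rfl
  have hinj : LinearMap.ker (Λ : (ℕ →ᵇ E) →ₗ[ℝ] S × (ℕ →ᵇ E)) = ⊥ := by
    rw [LinearMap.ker_eq_bot']
    intro u hu
    have hu1 : (Λ u).1 = 0 := congrArg Prod.fst hu
    have hu2 : (Λ u).2 = 0 := congrArg Prod.snd hu
    have h0 : u 0 = 0 := by
      rw [← horb u hu2, ← hPS, ← hΛ1, hu1]; rfl
    ext k
    induction k with
    | zero => exact h0
    | succ k ih =>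
      have h1 : u (k + 1) - B (u k) = 0 := by rw [← hΛ2, hu2]; rfl
      rw [sub_eq_zero.1 h1, ih]
      exact map_zero B
  have hsurj : LinearMap.range (Λ : (ℕ →ᵇ E) →ₗ[ℝ] S × (ℕ →ᵇ E)) = ⊤ := by
    rw [LinearMap.range_eq_top]
    rintro ⟨⟨_, x, rfl⟩, g⟩
    obtain ⟨u, hu1, hu2⟩ := exists_bounded_linear_solution hβ hβ1 hB hP x g
    refine ⟨u, Prod.ext (Subtype.ext ?_) ?_⟩
    · exact hu2
    · ext k; exact hu1 k
  let A := ContinuousLinearEquiv.ofBijective Λ hinj hsurj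
  have hA : (A : (ℕ →ᵇ E) →L[ℝ] S × (ℕ →ᵇ E)) = Λ := rfl
  obtain ⟨e, he0, -, he, -, hes⟩ := exists_openPartialHomeomorph_contDiffOn isOpen_univ
    hΨ.contDiffOn (mem_univ 0) A (hA ▸ hΛ)
  have hsymm0 : e.symm 0 = 0 := by
    conv_lhs => rw [← hΨ0, ← he]
    exact e.left_inv he0
  have ht0 : (0 : S × (ℕ →ᵇ E)) ∈ e.target := by
    have := e.map_source he0
    rwa [he, hΨ0] at this
  let Q : E →L[ℝ] S × (ℕ →ᵇ E) := PS.prod 0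
  have hQ0 : Q 0 = 0 := map_zero Q
  let U : Set E := Q ⁻¹' e.target
  have hUo : IsOpen U := e.open_target.preimage Q.continuous
  have hU0 : (0 : E) ∈ U := by change Q 0 ∈ e.target; rwa [hQ0]
  -- `G y` is the initial point of the bounded orbit with the same stable component as `y`
  let G : E → E := fun y => ev (e.symm (Q y))
  have hQU : MapsTo Q U e.target := fun y hy => hy
  have hG : ContDiffOn ℝ ∞ G U :=
    ev.contDiff.comp_contDiffOn (hes.comp Q.contDiff.contDiffOn hQU)
  have hG0 : G 0 = 0 := by change ev (e.symm (Q 0)) = 0; rw [hQ0, hsymm0, map_zero]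
  have hGΨ : ∀ y ∈ U, Ψ (e.symm (Q y)) = Q y := fun y hy => by rw [← he]; exact e.right_inv hy
  have hPG : ∀ y ∈ U, P (G y) = P y := fun y hy =>
    congrArg (fun p : S × (ℕ →ᵇ E) => (p.1 : E)) (hGΨ y hy)
  have hGorb : ∀ y ∈ U, ∀ k, φ^[k] (G y) = e.symm (Q y) k := by
    intro y hy k
    induction k with
    | zero => rfl
    | succ k ih =>
      have h1 := DFunLike.congr_fun (congrArg Prod.snd (hGΨ y hy)) k
      rw [Function.iterate_succ_apply', ih]
      exact (sub_eq_zero.1 h1).symm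
  have hGP : HasFDerivAt G P 0 := by
    have h1 : HasFDerivAt e.symm (A.symm : S × (ℕ →ᵇ E) →L[ℝ] (ℕ →ᵇ E)) 0 := by
      refine e.hasFDerivAt_symm ht0 ?_
      rw [hsymm0, hA]
      exact hΛ.congr_of_eventuallyEq (Eventually.of_forall he)
    rw [← hQ0] at h1
    refine ((ev.hasFDerivAt).comp 0 (h1.comp 0 Q.hasFDerivAt)).congr_fderiv ?_
    ext v
    have h2 : Λ (A.symm (Q v)) = Q v := A.apply_symm_apply (Q v)
    change (A.symm (Q v)) 0 = P v
    rw [← horb _ (congrArg Prod.snd h2), ← hPS, ← hΛ1, h2]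
    rfl
  have hfix : ∀ y ∈ U, P (y - G y + P y) = y - G y + P y → G y = y := by
    intro y hy h
    rw [map_add, map_sub, hPG y hy, sub_self, zero_add, stableProjection_idem hP] at h
    exact (sub_eq_zero.1 (add_eq_right.1 h.symm)).symm
  refine ⟨fun y => y - G y + P y, U, hUo, hU0,
    (contDiffOn_id.sub hG).add P.contDiff.contDiffOn, by simp [hG0], ?_, ?_, ?_⟩
  · refine (((hasFDerivAt_id 0).sub hGP).add P.hasFDerivAt).congr_fderiv ?_
    rw [sub_add_cancel]
  · obtain ⟨r, hr, hrs⟩ := Metric.isOpen_iff.1 e.open_source 0 he0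
    refine ⟨r / 2, half_pos hr, fun y hy => ?_⟩
    let u : ℕ →ᵇ E := BoundedContinuousFunction.ofNormedAddCommGroupDiscrete
      (fun k => φ^[k] y) (r / 2) hy
    have hus : u ∈ e.source := hrs (by
      rw [mem_ball_zero_iff]
      exact lt_of_le_of_lt ((norm_le (half_pos hr).le).2 hy) (half_lt_self hr))
    have hΨu : Ψ u = Q y := by
      refine Prod.ext rfl ?_
      ext k
      change φ^[k + 1] y - φ (φ^[k] y) = 0
      rw [Function.iterate_succ_apply', sub_self]
    have hGy : G y = y := by
      change ev (e.symm (Q y)) = y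
      rw [← hΨu, ← he, e.left_inv hus]
      rfl
    simp only [hGy, sub_self, zero_add, stableProjection_idem hP]
  · intro δ hδ
    have hc : ContinuousAt (fun y => e.symm (Q y)) 0 :=
      ((hes.continuousOn.comp Q.continuous.continuousOn hQU).continuousAt
        (hUo.mem_nhds hU0))
    have hb : Metric.ball (0 : ℕ →ᵇ E) δ ∈ 𝓝 (e.symm (Q 0)) := by
      rw [hQ0, hsymm0]; exact Metric.ball_mem_nhds _ hδ
    filter_upwards [hc hb, hUo.mem_nhds hU0] with y hy hyU h k
    have h1 := hGorb y hyU k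
    rw [hfix y hyU h] at h1
    rw [h1]
    exact ((e.symm (Q y)).norm_coe_le_norm k).trans_lt (mem_ball_zero_iff.1 hy)

end LocalStable

/-! ### Orbits near an isolated fixed point of a system with a Lyapunov function -/

section Lyapunov

variable {M : Type*} {φ : M → M} {f : M → ℝ}

theorem antitone_apply_iterate (hle : ∀ q, f (φ q) ≤ f q) (q : M) :
    Antitone fun k => f (φ^[k] q) :=
  antitone_nat_of_succ_le fun k => by rw [Function.iterate_succ_apply']; exact hle _

variable [TopologicalSpace M]

/-- An orbit that stays in a compact set with a single fixed point converges to that point. -/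
theorem tendsto_iterate_of_forall_mem (hφ : Continuous φ) (hf : Continuous f)
    (hle : ∀ q, f (φ q) ≤ f q) (heq : ∀ q, f (φ q) = f q → φ q = q) {K : Set M} (hK : IsCompact K)
    {x : M} (hfix : ∀ q ∈ K, φ q = q → q = x) {q : M} (hq : ∀ k, φ^[k] q ∈ K) :
    Tendsto (fun k => φ^[k] q) atTop (𝓝 x) := by
  obtain ⟨C, hC⟩ := hK.bddBelow_image hf.continuousOn
  have hlim := tendsto_atTop_ciInf (antitone_apply_iterate hle q)
    ⟨C, by rintro _ ⟨k, rfl⟩; exact hC ⟨_, hq k, rfl⟩⟩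
  set L := ⨅ k, f (φ^[k] q)
  refine hK.tendsto_nhds_of_unique_mapClusterPt (Eventually.of_forall hq) fun p hp hcl => ?_
  obtain ⟨𝒰, h𝒰, hp𝒰⟩ := mapClusterPt_iff_ultrafilter.1 hcl
  have h1 : f p = L := tendsto_nhds_unique ((hf.tendsto p).comp hp𝒰) (hlim.mono_left h𝒰)
  have h2 : f (φ p) = L := by
    refine tendsto_nhds_unique (((hf.comp hφ).tendsto p).comp hp𝒰)
      (((tendsto_add_atTop_iff_nat 1).2 hlim).mono_left h𝒰 |>.congr fun k => ?_)
    rw [Function.iterate_succ_apply']; rfl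
  exact hfix p hp (heq p (h2.trans h1.symm))

/-- Orbits that start near an isolated fixed point and converge to it do not go far away in
between: on leaving they would lose a definite amount of `f`. -/
theorem exists_nhds_forall_iterate_mem [LocallyCompactSpace M] (hφ : Continuous φ)
    (hf : Continuous f) (hle : ∀ q, f (φ q) ≤ f q) (heq : ∀ q, f (φ q) = f q → φ q = q)
    {x : M} (hx : φ x = x) {O : Set M} (hO : O ∈ 𝓝 x) (hfix : ∀ q ∈ O, φ q = q → q = x) :
    ∃ V ∈ 𝓝 x, ∀ q ∈ V, Tendsto (fun k => φ^[k] q) atTop (𝓝 x) → ∀ k, φ^[k] q ∈ O := by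
  obtain ⟨K, hKx, hKO, hK⟩ := local_compact_nhds hO
  let O' : Set M := interior K ∩ φ ⁻¹' interior K
  have hO'o : IsOpen O' := isOpen_interior.inter (isOpen_interior.preimage hφ)
  have hxK : x ∈ interior K := mem_interior_iff_mem_nhds.2 hKx
  have hxO' : x ∈ O' := ⟨hxK, by rw [mem_preimage, hx]; exact hxK⟩
  have hD : IsCompact (K \ O') := hK.diff hO'o
  have hpos : ∀ p ∈ K \ O', 0 < f p - f (φ p) := by
    intro p hp
    refine sub_pos.2 (lt_of_le_of_ne (hle p) fun h => hp.2 ?_)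
    rw [hfix p (hKO hp.1) (heq p h)]
    exact hxO'
  obtain ⟨c, hc, hcD⟩ : ∃ c > 0, ∀ p ∈ K \ O', c ≤ f p - f (φ p) := by
    rcases (K \ O').eq_empty_or_nonempty with h | h
    · exact ⟨1, one_pos, by simp [h]⟩
    · obtain ⟨p, hp, hmin⟩ := hD.exists_isMinOn h (hf.sub (hf.comp hφ)).continuousOn
      exact ⟨_, hpos p hp, fun p' hp' => hmin hp'⟩
  refine ⟨O' ∩ {q | f q < f x + c}, inter_mem (hO'o.mem_nhds hxO')
    ((isOpen_lt hf continuous_const).mem_nhds (by simp [hc])), ?_⟩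
  rintro q ⟨hqO', hqc⟩ hq
  have hge : ∀ k, f x ≤ f (φ^[k] q) :=
    fun k => (antitone_apply_iterate hle q).le_of_tendsto ((hf.tendsto x).comp hq) k
  suffices h : ∀ k, φ^[k] q ∈ O' from fun k => hKO (interior_subset (h k).1)
  intro k
  induction k with
  | zero => exact hqO'
  | succ k ih =>
    by_contra hnot
    have hmem : φ^[k + 1] q ∈ K := by
      rw [Function.iterate_succ_apply']; exact interior_subset ih.2
    have h1 := hcD _ ⟨hmem, hnot⟩
    have h2 := hge (k + 2)
    have h3 : f (φ^[k + 1] q) ≤ f q := antitone_apply_iterate hle q (Nat.zero_le (k + 1))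
    rw [Function.iterate_succ_apply'] at h2
    have h4 : f q < f x + c := hqc
    linarith

end Lyapunov

section StraighteningAt

variable {E : Type} [NormedAddCommGroup E] [NormedSpace ℝ E] [FiniteDimensional ℝ E]
  {ι : Type} {b : Module.Basis ι ℝ E} {β : ι → ℝ} {B P : E →L[ℝ] E}

/-- The straightening of the stable set at a hyperbolic fixed point `y₀`, by translation to `0`. -/
theorem exists_stable_straightening_at [Fintype ι] {φ : E → E} (hφ : ContDiff ℝ ∞ φ) {y₀ : E}
    (hφ0 : φ y₀ = y₀) (hφB : fderiv ℝ φ y₀ = B) (hβ : ∀ i, 0 < β i) (hβ1 : ∀ i, β i ≠ 1)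
    (hB : ∀ i, B (b i) = β i • b i) (hP : ∀ i, P (b i) = if β i < 1 then b i else 0) :
    ∃ (H : E → E) (U : Set E), IsOpen U ∧ y₀ ∈ U ∧ ContDiffOn ℝ ∞ H U ∧ H y₀ = 0 ∧
      HasFDerivAt H (ContinuousLinearMap.id ℝ E) y₀ ∧
      (∃ δ > 0, ∀ y, (∀ k, ‖φ^[k] y - y₀‖ ≤ δ) → P (H y) = H y) ∧
      (∀ δ > 0, ∀ᶠ y in 𝓝 y₀, P (H y) = H y → ∀ k, ‖φ^[k] y - y₀‖ < δ) := by
  have hdiff : Differentiable ℝ φ := hφ.differentiable (by simp)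
  have hd : fderiv ℝ (fun z => φ (z + y₀) - y₀) 0 = B := by
    rw [fderiv_sub_const, fderiv_comp_add_right, zero_add, hφB]
  obtain ⟨H, U, hU, h0U, hH, hH0, hHd, ⟨δ, hδ, h1⟩, h2⟩ := exists_stable_straightening
    (φ := fun z => φ (z + y₀) - y₀) ((hφ.comp (contDiff_id.add contDiff_const)).sub contDiff_const)
    (by simp [hφ0]) hd hβ hβ1 hB hP
  have hit : ∀ k y, (fun z => φ (z + y₀) - y₀)^[k] (y - y₀) = φ^[k] y - y₀ := by
    intro k y
    induction k with
    | zero => rfl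
    | succ k ih => rw [Function.iterate_succ_apply', ih, Function.iterate_succ_apply']; simp
  have hs : ContDiff ℝ ∞ fun y : E => y - y₀ := contDiff_id.sub contDiff_const
  refine ⟨fun y => H (y - y₀), (fun y => y - y₀) ⁻¹' U, hU.preimage hs.continuous, by simpa,
    hH.comp hs.contDiffOn fun y hy => hy, by simpa, ?_, ⟨δ, hδ, fun y hy => ?_⟩, fun δ hδ => ?_⟩
  · have hHd' : HasFDerivAt H (ContinuousLinearMap.id ℝ E) (y₀ - y₀) := by rwa [sub_self]
    exact hHd'.comp y₀ (f := fun y => y - y₀) ((hasFDerivAt_id y₀).sub_const y₀)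
  · exact h1 _ fun k => by rw [hit]; exact hy k
  · have hc : Tendsto (fun y : E => y - y₀) (𝓝 y₀) (𝓝 0) := by
      simpa using hs.continuous.tendsto y₀
    filter_upwards [hc.eventually (h2 δ hδ)] with y hy hyP k
    rw [← hit]
    exact hy hyP k

/-- A hyperbolic fixed point is isolated among the fixed points, since `B - 1` is injective. -/
theorem eventually_eq_of_hyperbolic_fixed_point {φ : E → E} {y₀ : E}
    (hφB : HasFDerivAt φ B y₀) (hβ1 : ∀ i, β i ≠ 1)
    (hB : ∀ i, B (b i) = β i • b i) : ∀ᶠ y in 𝓝 y₀, φ y = y → y = y₀ := by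
  have hinj : LinearMap.ker ((B - ContinuousLinearMap.id ℝ E : E →L[ℝ] E) : E →ₗ[ℝ] E) = ⊥ := by
    rw [LinearMap.ker_eq_bot']
    intro v hv
    have hv' : B v = v := sub_eq_zero.1 hv
    refine b.ext_elem fun i => ?_
    have h1 := coord_map_of_eigenbasis hB i v
    rw [hv'] at h1
    have h2 : (β i - 1) * b.repr v i = 0 := by linarith
    simpa using (mul_eq_zero.1 h2).resolve_left (sub_ne_zero.2 (hβ1 i))
  obtain ⟨C, -, hC⟩ := LinearMap.exists_antilipschitzWith _ hinj
  have hne := (hφB.sub (hasFDerivAt_id y₀)).eventually_ne (c := 0) ⟨C, hC⟩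
  rw [eventually_nhdsWithin_iff] at hne
  filter_upwards [hne] with y hy h
  by_contra hyne
  exact hy hyne (by simp [h])

end StraighteningAt

/-! ### The stable set of a hyperbolic fixed point in a manifold -/

/-- The set of points whose forward orbit under `φ` converges to `x`. -/
def stableSet {M : Type*} [TopologicalSpace M] (φ : M → M) (x : M) : Set M :=
  {q | Tendsto (fun k => φ^[k] q) atTop (𝓝 x)}

theorem iterate_mem_stableSet {M : Type*} [TopologicalSpace M] {φ : M → M} {x q : M} (m : ℕ) :
    φ^[m] q ∈ stableSet φ x ↔ q ∈ stableSet φ x := by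
  simp only [stableSet, mem_ofPred_eq, ← Function.iterate_add_apply]
  exact tendsto_add_atTop_iff_nat (f := fun k => φ^[k] q) m

section SliceChart

variable {n : ℕ} {M : Type*} [TopologicalSpace M] [ChartedSpace (EuclideanSpace ℝ (Fin n)) M]
  [IsManifold (𝓡 n) ∞ M]

local notation "𝔼" => EuclideanSpace ℝ (Fin n)

theorem contDiffOn_writtenInChart {φ : M → M} (hφ : ContMDiff (𝓡 n) (𝓡 n) ∞ φ) (x : M) :
    ContDiffOn ℝ ∞ (chartAt 𝔼 x ∘ φ ∘ (chartAt 𝔼 x).symm)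
      ((chartAt 𝔼 x).target ∩ (chartAt 𝔼 x).symm ⁻¹' (φ ⁻¹' (chartAt 𝔼 x).source)) := by
  rw [← contMDiffOn_iff_contDiffOn]
  have h1 : ContMDiffOn (𝓡 n) (𝓡 n) ∞ (chartAt 𝔼 x) (chartAt 𝔼 x).source := contMDiffOn_chart
  have h2 : ContMDiffOn (𝓡 n) (𝓡 n) ∞ (chartAt 𝔼 x).symm (chartAt 𝔼 x).target :=
    contMDiffOn_chart_symm
  exact h1.comp (hφ.comp_contMDiffOn (h2.mono inter_subset_left)) fun y hy => hy.2

/-- A chart around a hyperbolic fixed point in which the stable set is the stable subspace (the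
range of `P`), and whose derivative, in the preferred chart at the fixed point, is the identity.
The strict Lyapunov function `f` prevents orbits that converge to `x` from leaving a neighbourhood
of `x` and coming back, so the stable set near `x` is given by the orbits that stay near `x`. -/
theorem exists_slice_chart [T2Space M] {φ : M → M} {f : M → ℝ}
    (hφ : ContMDiff (𝓡 n) (𝓡 n) ∞ φ)
    (hf : Continuous f) (hle : ∀ q, f (φ q) ≤ f q) (heq : ∀ q, f (φ q) = f q → φ q = q)
    {x : M} (hx : φ x = x) {ι : Type} [Fintype ι] {b : Module.Basis ι ℝ 𝔼}
    {β : ι → ℝ} {B P : 𝔼 →L[ℝ] 𝔼}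
    (hφB : fderiv ℝ (chartAt 𝔼 x ∘ φ ∘ (chartAt 𝔼 x).symm) (chartAt 𝔼 x x) = B)
    (hβ : ∀ i, 0 < β i) (hβ1 : ∀ i, β i ≠ 1)
    (hB : ∀ i, B (b i) = β i • b i) (hP : ∀ i, P (b i) = if β i < 1 then b i else 0) :
    ∃ Θ ∈ IsManifold.maximalAtlas (𝓡 n) ∞ M, x ∈ Θ.source ∧ Θ x = 0 ∧
      Θ.source ⊆ (chartAt 𝔼 x).source ∧
      (∀ q ∈ Θ.source, q ∈ stableSet φ x ↔ P (Θ q) = Θ q) ∧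
      HasFDerivAt (Θ ∘ (chartAt 𝔼 x).symm) (ContinuousLinearMap.id ℝ 𝔼) (chartAt 𝔼 x x) ∧
      HasFDerivAt (chartAt 𝔼 x ∘ Θ.symm) (ContinuousLinearMap.id ℝ 𝔼) 0 := by
  have : LocallyCompactSpace M := ChartedSpace.locallyCompactSpace 𝔼 M
  have hφc : Continuous φ := hφ.continuous
  set c := chartAt 𝔼 x with hc
  have hxs : x ∈ c.source := mem_chart_source 𝔼 x
  set y₀ := c x with hy₀
  have hyt : y₀ ∈ c.target := c.map_source hxs
  have hsy : c.symm y₀ = x := c.left_inv hxs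
  have hF := contDiffOn_writtenInChart hφ x
  rw [← hc] at hF
  set V₀ := c.target ∩ c.symm ⁻¹' (φ ⁻¹' c.source)
  have hV₀o : IsOpen V₀ := c.isOpen_inter_preimage_symm (c.open_source.preimage hφc)
  have hV₀ : y₀ ∈ V₀ := ⟨hyt, by simp only [mem_preimage, hsy, hx]; exact hxs⟩
  obtain ⟨φ', hφ', heqφ⟩ := exists_contDiff_eventuallyEq hF (hV₀o.mem_nhds hV₀)
  have hφ'0 : φ' y₀ = y₀ := by
    rw [heqφ.eq_of_nhds]; simp only [Function.comp_apply, hsy, hx]; exact hy₀.symm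
  have hφ'B : fderiv ℝ φ' y₀ = B := by rw [heqφ.fderiv_eq, hφB]
  obtain ⟨H, U, hU, hyU, hH, hH0, hHd, ⟨δ, hδ, hst1⟩, hst2⟩ :=
    exists_stable_straightening_at hφ' hφ'0 hφ'B hβ hβ1 hB hP
  obtain ⟨e, hye, heU, he, hes, hess⟩ := exists_openPartialHomeomorph_contDiffOn hU hH hyU
    (ContinuousLinearEquiv.refl ℝ 𝔼) hHd
  have hcx : Tendsto c (𝓝 x) (𝓝 y₀) := c.continuousAt hxs
  have hcsy : Tendsto c.symm (𝓝 y₀) (𝓝 x) := by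
    have := c.continuousAt_symm hyt
    rwa [ContinuousAt, hsy] at this
  -- the region where the chart conjugates `φ` to `φ'` and where `x` is the only fixed point
  let O : Set M := {q | q ∈ c.source ∧ φ q ∈ c.source ∧ φ' (c q) = c (φ q) ∧
    (φ q = q → q = x) ∧ ‖c q - y₀‖ ≤ δ}
  have hO : O ∈ 𝓝 x := by
    have h1 : ∀ᶠ q in 𝓝 x, q ∈ c.source := c.open_source.mem_nhds hxs
    have h2 : ∀ᶠ q in 𝓝 x, φ q ∈ c.source :=
      (c.open_source.preimage hφc).mem_nhds (by rw [mem_preimage, hx]; exact hxs)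
    have h3 := hcx.eventually heqφ
    have h4 := hcx.eventually (eventually_eq_of_hyperbolic_fixed_point
      (hφ'B ▸ (hφ'.differentiable (by simp) y₀).hasFDerivAt) hβ1 hB)
    have h5 : ∀ᶠ q in 𝓝 x, ‖c q - y₀‖ ≤ δ := by
      filter_upwards [hcx (Metric.closedBall_mem_nhds y₀ hδ)] with q hq
      exact mem_closedBall_iff_norm.1 hq
    filter_upwards [h1, h2, h3, h4, h5] with q hq1 hq2 hq3 hq4 hq5
    have hq3' : φ' (c q) = c (φ q) := by
      rw [hq3]; simp only [Function.comp_apply, c.left_inv hq1]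
    refine ⟨hq1, hq2, hq3', fun hfix => ?_, hq5⟩
    have := hq4 (by rw [hq3', hfix])
    exact c.injOn hq1 hxs this
  have hconj : ∀ q, (∀ k, φ^[k] q ∈ O) → ∀ k, φ'^[k] (c q) = c (φ^[k] q) := by
    intro q hq k
    induction k with
    | zero => rfl
    | succ k ih =>
      rw [Function.iterate_succ_apply', ih, Function.iterate_succ_apply', (hq k).2.2.1]
  obtain ⟨V, hV, hVO⟩ := exists_nhds_forall_iterate_mem hφc hf hle heq hx hO
    fun q hq => hq.2.2.2.1
  obtain ⟨K, hKx, hKO, hK⟩ := local_compact_nhds hO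
  obtain ⟨δ', hδ', hball⟩ := Metric.mem_nhds_iff.1
    (inter_mem (c.open_target.mem_nhds hyt) (hcsy hKx))
  have hiff : ∀ᶠ q in 𝓝 x, q ∈ stableSet φ x ↔ P (H (c q)) = H (c q) := by
    filter_upwards [hV, hKx, hcx.eventually (hst2 δ' hδ')] with q hqV hqK hq
    constructor
    · intro hqs
      have hqO := hVO q hqV hqs
      exact hst1 _ fun k => by rw [hconj q hqO]; exact (hqO k).2.2.2.2
    · intro hqP
      have hsm := hq hqP
      have hmem : ∀ k, φ^[k] q ∈ K ∧ φ'^[k] (c q) = c (φ^[k] q) := by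
        intro k
        induction k with
        | zero => exact ⟨hqK, rfl⟩
        | succ k ih =>
          have hO' := hKO ih.1
          have h1 : φ'^[k + 1] (c q) = c (φ^[k + 1] q) := by
            rw [Function.iterate_succ_apply', ih.2, Function.iterate_succ_apply', hO'.2.2.1]
          have h2 := hball (mem_ball_iff_norm.2 (hsm (k + 1)))
          have h3 : φ^[k + 1] q ∈ c.source := by
            rw [Function.iterate_succ_apply']; exact hO'.2.1
          have h4 := h2.2
          rw [mem_preimage, h1, c.left_inv h3] at h4
          exact ⟨h4, h1⟩
      exact tendsto_iterate_of_forall_mem hφc hf hle heq hK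
        (fun q hq => (hKO hq).2.2.2.1) fun k => (hmem k).1
  obtain ⟨W, hW, hWo, hxW⟩ := eventually_nhds_iff.1 hiff
  let Θ := (c.trans e).restrOpen W hWo
  have hΘs : Θ.source = (c.source ∩ c ⁻¹' e.source) ∩ W := rfl
  have hΘ : ∀ q, Θ q = H (c q) := fun q => he (c q)
  have hΘsymm : ∀ z, Θ.symm z = c.symm (e.symm z) := fun z => rfl
  have hxΘ : x ∈ Θ.source := ⟨⟨hxs, hye⟩, hxW⟩
  have hΘx : Θ x = 0 := by rw [hΘ]; exact hH0
  have hΘt : ∀ z ∈ Θ.target, z ∈ e.target ∧ e.symm z ∈ c.target := fun z hz => hz.1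
  refine ⟨Θ, Θ.mem_maximalAtlas_of_contMDiffOn ?_ ?_, hxΘ, hΘx, fun q hq => hq.1.1,
    fun q hq => ?_, ?_, ?_⟩
  · have h1 : ContMDiffOn (𝓡 n) (𝓡 n) ∞ c c.source := contMDiffOn_chart
    have h2 : Θ.source ⊆ c.source := fun q hq => hq.1.1
    have h3 : MapsTo c Θ.source e.source := fun q hq => hq.1.2
    exact hes.contMDiffOn.comp (h1.mono h2) h3
  · have h1 : ContMDiffOn (𝓡 n) (𝓡 n) ∞ c.symm c.target := contMDiffOn_chart_symm
    have h2 : Θ.target ⊆ e.target := fun z hz => (hΘt z hz).1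
    have h3 : MapsTo e.symm Θ.target c.target := fun z hz => (hΘt z hz).2
    exact h1.comp (hess.contMDiffOn.mono h2) h3
  · rw [hΘ]; exact hW q hq.2
  · refine hHd.congr_of_eventuallyEq ?_
    filter_upwards [c.open_target.mem_nhds hyt] with y hy
    rw [Function.comp_apply, hΘ, c.right_inv hy]
  · have h0t : (0 : 𝔼) ∈ e.target := by
      have := e.map_source hye
      rwa [he, hH0] at this
    have hes0 : e.symm 0 = y₀ := by
      rw [← hH0, ← he, e.left_inv hye]
    have h1 : HasFDerivAt e.symm
        ((ContinuousLinearEquiv.refl ℝ 𝔼).symm : 𝔼 →L[ℝ] 𝔼) 0 := by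
      refine e.hasFDerivAt_symm h0t ?_
      rw [hes0]
      exact hHd.congr_of_eventuallyEq (Eventually.of_forall he)
    refine HasFDerivAt.congr_of_eventuallyEq (f := e.symm) h1 ?_
    have h2 : ContinuousAt e.symm 0 := e.continuousAt_symm h0t
    filter_upwards [h2.eventually (c.open_target.mem_nhds (hes0 ▸ hyt))] with z hz
    rw [Function.comp_apply, hΘsymm, c.right_inv hz]

end SliceChart

/-! ### Stable sets as embedded submanifolds -/

section Submanifold

variable {n : ℕ} {M : Type*} [TopologicalSpace M] [ChartedSpace (EuclideanSpace ℝ (Fin n)) M]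

local notation "𝔼" => EuclideanSpace ℝ (Fin n)

theorem contMDiff_iterate {φ : M → M} (hφ : ContMDiff (𝓡 n) (𝓡 n) ∞ φ) (k : ℕ) :
    ContMDiff (𝓡 n) (𝓡 n) ∞ φ^[k] := by
  induction k with
  | zero => exact contMDiff_id
  | succ k ih => exact ih.comp hφ

/-- The velocity of a curve in a manifold, read off in the preferred chart. -/
theorem hasMFDerivAt_curve_iff {γ : ℝ → M} {t : ℝ} {v : 𝔼} :
    HasMFDerivAt 𝓘(ℝ, ℝ) (𝓡 n) γ t
      ((1 : ℝ →L[ℝ] ℝ).smulRight (show TangentSpace (𝓡 n) (γ t) from v)) ↔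
      ContinuousAt γ t ∧ HasDerivAt (chartAt 𝔼 (γ t) ∘ γ) v t := by
  refine and_congr Iff.rfl ?_
  have h : HasFDerivWithinAt (writtenInExtChartAt 𝓘(ℝ, ℝ) (𝓡 n) t γ)
      ((1 : ℝ →L[ℝ] ℝ).smulRight v) (range 𝓘(ℝ, ℝ)) (extChartAt 𝓘(ℝ, ℝ) t t) ↔
      HasFDerivWithinAt (chartAt 𝔼 (γ t) ∘ γ) ((1 : ℝ →L[ℝ] ℝ).smulRight v)
        (range 𝓘(ℝ, ℝ)) t := Iff.rfl
  refine h.trans ?_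
  rw [ModelWithCorners.range_eq_univ, hasFDerivWithinAt_univ]
  exact hasDerivAt_iff_hasFDerivAt.symm

/-- The tangent vectors at `x` of a set that is a linear subspace in a chart whose derivative at
`x` is the identity. -/
theorem mem_tangentVectors_iff_of_slice_chart {W : Set M} {x : M}
    {Θ : OpenPartialHomeomorph M 𝔼} (hΘ : Θ ∈ IsManifold.maximalAtlas (𝓡 n) ∞ M)
    (hxΘ : x ∈ Θ.source) (hΘx : Θ x = 0) (hsub : Θ.source ⊆ (chartAt 𝔼 x).source)
    {S : Submodule ℝ 𝔼} (hS : ∀ q ∈ Θ.source, q ∈ W ↔ Θ q ∈ S)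
    (hd : HasFDerivAt (Θ ∘ (chartAt 𝔼 x).symm) (ContinuousLinearMap.id ℝ 𝔼) (chartAt 𝔼 x x))
    (hd' : HasFDerivAt (chartAt 𝔼 x ∘ Θ.symm) (ContinuousLinearMap.id ℝ 𝔼) 0) (v : 𝔼) :
    (show TangentSpace (𝓡 n) x from v) ∈ tangentVectors (n := n) W x ↔ v ∈ S := by
  constructor
  · rintro ⟨γ, ε, hε, hsm, hW, h0, hγ⟩
    subst h0
    obtain ⟨hγc, hc1⟩ := hasMFDerivAt_curve_iff.1 hγ
    have hc2 : HasDerivAt (Θ ∘ γ) v 0 := by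
      have h1 := HasFDerivAt.comp_hasDerivAt (f := chartAt 𝔼 (γ 0) ∘ γ) (0 : ℝ) hd hc1
      refine HasDerivAt.congr_of_eventuallyEq h1 ?_
      filter_upwards [hγc.eventually (Θ.open_source.mem_nhds hxΘ)] with t ht
      simp only [Function.comp_apply]
      rw [(chartAt 𝔼 (γ 0)).left_inv (hsub ht)]
    have hclosed : IsClosed (S : Set 𝔼) := S.closed_of_finiteDimensional
    have hslope := hasDerivAt_iff_tendsto_slope.1 hc2
    refine hclosed.mem_of_tendsto hslope ?_
    have h1 : ∀ᶠ t in 𝓝[≠] (0 : ℝ), γ t ∈ Θ.source :=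
      (hγc.eventually (Θ.open_source.mem_nhds hxΘ)).filter_mono nhdsWithin_le_nhds
    have h2 : ∀ᶠ t in 𝓝[≠] (0 : ℝ), t ∈ Ioo (-ε) ε :=
      nhdsWithin_le_nhds (Ioo_mem_nhds (by linarith) hε)
    filter_upwards [h1, h2] with t ht1 ht2
    rw [slope_def_module, Function.comp_apply, Function.comp_apply, hΘx]
    exact S.smul_mem _ (S.sub_mem ((hS _ ht1).1 (hW t ht2)) S.zero_mem)
  · intro hv
    let ℓ : ℝ → 𝔼 := fun t => t • v
    have hℓ0 : ℓ 0 = 0 := zero_smul ℝ _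
    have hℓ : ContDiff ℝ ∞ ℓ := contDiff_id.smul contDiff_const
    have h0t : (0 : 𝔼) ∈ Θ.target := hΘx ▸ Θ.map_source hxΘ
    have hΘ0 : Θ.symm 0 = x := by rw [← hΘx, Θ.left_inv hxΘ]
    have hopen : IsOpen (ℓ ⁻¹' Θ.target) := Θ.open_target.preimage hℓ.continuous
    obtain ⟨ε, hε, hball⟩ := Metric.isOpen_iff.1 hopen 0 (by rw [mem_preimage, hℓ0]; exact h0t)
    rw [Real.ball_eq_Ioo, zero_sub, zero_add] at hball
    have hsm : ContMDiffOn 𝓘(ℝ, ℝ) (𝓡 n) ∞ (Θ.symm ∘ ℓ) (Ioo (-ε) ε) :=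
      (contMDiffOn_symm_of_mem_maximalAtlas hΘ).comp hℓ.contMDiff.contMDiffOn hball
    have h0 : (Θ.symm ∘ ℓ) 0 = x := by rw [Function.comp_apply, hℓ0, hΘ0]
    have hder : HasDerivAt (chartAt 𝔼 x ∘ Θ.symm ∘ ℓ) v 0 := by
      have h1 : HasDerivAt ℓ v 0 := by
        simpa using (hasDerivAt_id (0 : ℝ)).smul_const v
      rw [← hℓ0] at hd'
      exact HasFDerivAt.comp_hasDerivAt (f := ℓ) (0 : ℝ) hd' h1
    refine ⟨Θ.symm ∘ ℓ, ε, hε, hsm, fun t ht => ?_, h0, ?_⟩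
    · refine (hS _ (Θ.map_target (hball ht))).2 ?_
      rw [Θ.right_inv (hball ht)]
      exact S.smul_mem t hv
    · refine hasMFDerivAt_curve_iff.2
        ⟨hsm.continuousOn.continuousAt (Ioo_mem_nhds (by linarith) hε), ?_⟩
      rw [h0]
      exact hder

variable [IsManifold (𝓡 n) ∞ M]

/-- A slice chart for the stable set at the fixed point is transported along the orbits of the
diffeomorphism `φ` to a slice chart at any other point of the stable set. -/
theorem isEmbeddedSubmanifold_stableSet {φ ψ : M → M}
    (hφ : ContMDiff (𝓡 n) (𝓡 n) ∞ φ) (hψ : ContMDiff (𝓡 n) (𝓡 n) ∞ ψ)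
    (hψφ : Function.LeftInverse ψ φ) (hφψ : Function.LeftInverse φ ψ) {x : M}
    {Θ : OpenPartialHomeomorph M 𝔼} (hΘ : Θ ∈ IsManifold.maximalAtlas (𝓡 n) ∞ M)
    (hxΘ : x ∈ Θ.source) {S : Submodule ℝ 𝔼}
    (hS : ∀ q ∈ Θ.source, q ∈ stableSet φ x ↔ Θ q ∈ S) :
    IsEmbeddedSubmanifold n (Module.finrank ℝ S) (stableSet φ x) := by
  intro p hp
  have hp' : Tendsto (fun k => φ^[k] p) atTop (𝓝 x) := hp
  obtain ⟨k, hk⟩ := (hp'.eventually (Θ.open_source.mem_nhds hxΘ)).exists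
  let h : M ≃ₜ M :=
    { toFun := φ^[k]
      invFun := ψ^[k]
      left_inv := hψφ.iterate k
      right_inv := hφψ.iterate k
      continuous_toFun := (contMDiff_iterate hφ k).continuous
      continuous_invFun := (contMDiff_iterate hψ k).continuous }
  let Θ' := h.toOpenPartialHomeomorph.trans Θ
  have hsrc : ∀ q, q ∈ Θ'.source ↔ φ^[k] q ∈ Θ.source := fun q => by
    simp [Θ', h]
  have happ : ∀ q, Θ' q = Θ (φ^[k] q) := fun q => rfl
  have htgt : Θ'.target = Θ.target := by simp [Θ']
  have hsymm : ∀ z, Θ'.symm z = ψ^[k] (Θ.symm z) := fun z => rfl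
  refine ⟨Θ', Θ'.mem_maximalAtlas_of_contMDiffOn ?_ ?_, (hsrc p).2 hk, S, rfl, ?_⟩
  · have h1 : MapsTo φ^[k] Θ'.source Θ.source := fun q hq => (hsrc q).1 hq
    exact (contMDiffOn_of_mem_maximalAtlas hΘ).comp
      ((contMDiff_iterate hφ k).contMDiffOn (s := Θ'.source)) h1
  · rw [htgt]
    exact (contMDiff_iterate hψ k).comp_contMDiffOn (contMDiffOn_symm_of_mem_maximalAtlas hΘ)
  · ext z
    constructor
    · rintro ⟨q, ⟨hq, hqW⟩, rfl⟩
      exact ⟨Θ'.map_source hq, (hS _ ((hsrc q).1 hq)).1 ((iterate_mem_stableSet k).2 hqW)⟩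
    · rintro ⟨hz, hzS⟩
      have h1 := Θ'.map_target hz
      have h2 := Θ'.right_inv hz
      refine ⟨Θ'.symm z, ⟨h1, ?_⟩, h2⟩
      rw [← iterate_mem_stableSet k, hS _ ((hsrc _).1 h1), ← happ, h2]
      exact hzS

end Submanifold

/-! ### Vector fields and metrics in a chart -/

section Coordinates

variable {n : ℕ} {M : Type*} [TopologicalSpace M] [ChartedSpace (EuclideanSpace ℝ (Fin n)) M]
  [IsManifold (𝓡 n) ∞ M]

local notation "𝔼" => EuclideanSpace ℝ (Fin n)

/-- The isomorphism from the coordinate space to the tangent space at `q` given by the chart at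
`x₀`. -/
noncomputable def frameAt (x₀ q : M) : 𝔼 →L[ℝ] TangentSpace (𝓡 n) q :=
  (trivializationAt 𝔼 (TangentSpace (𝓡 n)) x₀).symmL ℝ q

/-- The coordinates of the vector field `X` at `q` in the chart at `x₀`. -/
noncomputable def coordAt (x₀ : M) (X : (p : M) → TangentSpace (𝓡 n) p) (q : M) : 𝔼 :=
  ((trivializationAt 𝔼 (TangentSpace (𝓡 n)) x₀) (⟨q, X q⟩ : TangentBundle (𝓡 n) M)).2

theorem mem_baseSet_trivializationAt {x₀ q : M} (hq : q ∈ (chartAt 𝔼 x₀).source) :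
    q ∈ (trivializationAt 𝔼 (TangentSpace (𝓡 n)) x₀).baseSet := by
  rwa [TangentBundle.trivializationAt_baseSet]

theorem frameAt_coordAt {x₀ q : M} (hq : q ∈ (chartAt 𝔼 x₀).source)
    (X : (p : M) → TangentSpace (𝓡 n) p) : frameAt x₀ q (coordAt x₀ X q) = X q := by
  have h := (trivializationAt 𝔼 (TangentSpace (𝓡 n)) x₀).symmL_continuousLinearMapAt (R := ℝ)
    (mem_baseSet_trivializationAt hq) (X q)
  rwa [Bundle.Trivialization.continuousLinearMapAt_apply_of_mem ℝ _
    (mem_baseSet_trivializationAt hq)] at h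

theorem coord_frameAt {x₀ q : M} (hq : q ∈ (chartAt 𝔼 x₀).source) (w : 𝔼) :
    ((trivializationAt 𝔼 (TangentSpace (𝓡 n)) x₀)
      (⟨q, frameAt x₀ q w⟩ : TangentBundle (𝓡 n) M)).2 = w := by
  have h := (trivializationAt 𝔼 (TangentSpace (𝓡 n)) x₀).continuousLinearMapAt_symmL (R := ℝ)
    (mem_baseSet_trivializationAt hq) w
  rwa [Bundle.Trivialization.continuousLinearMapAt_apply_of_mem ℝ _
    (mem_baseSet_trivializationAt hq)] at h

theorem hasMFDerivAt_chartAt_symm {x₀ : M} {y : 𝔼} (hy : y ∈ (chartAt 𝔼 x₀).target) :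
    HasMFDerivAt 𝓘(ℝ, 𝔼) (𝓡 n) (chartAt 𝔼 x₀).symm y (frameAt x₀ ((chartAt 𝔼 x₀).symm y)) := by
  have h1 : MDifferentiableAt (𝓡 n) (𝓡 n) (chartAt 𝔼 x₀).symm y :=
    mdifferentiableAt_atlas_symm (ChartedSpace.chart_mem_atlas x₀) hy
  have h2 := TangentBundle.symmL_trivializationAt (I := 𝓡 n) (𝕜 := ℝ) (x₀ := x₀)
    ((chartAt 𝔼 x₀).map_target hy)
  have h3 : extChartAt (𝓡 n) x₀ ((chartAt 𝔼 x₀).symm y) = y := by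
    simp [hy]
  rw [h3, ModelWithCorners.range_eq_univ, mfderivWithin_univ] at h2
  have h4 := h1.hasMFDerivAt
  rw [frameAt, h2]
  exact h4

/-- The inverse chart carries solutions of the differential equation in coordinates to integral
curves. -/
theorem hasMFDerivAt_chartAt_symm_comp {x₀ : M} {X : (p : M) → TangentSpace (𝓡 n) p}
    {u : ℝ → 𝔼} {t : ℝ} (hy : u t ∈ (chartAt 𝔼 x₀).target)
    (hu : HasDerivAt u (coordAt x₀ X ((chartAt 𝔼 x₀).symm (u t))) t) :
    HasMFDerivAt 𝓘(ℝ, ℝ) (𝓡 n) ((chartAt 𝔼 x₀).symm ∘ u) t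
      ((1 : ℝ →L[ℝ] ℝ).smulRight (X ((chartAt 𝔼 x₀).symm (u t)))) := by
  have h1 := (hasMFDerivAt_chartAt_symm hy).comp t hu.hasFDerivAt.hasMFDerivAt
  refine h1.congr_mfderiv ?_
  have h2 : ∀ s : ℝ, frameAt x₀ ((chartAt 𝔼 x₀).symm (u t))
      (s • coordAt x₀ X ((chartAt 𝔼 x₀).symm (u t))) = s • X ((chartAt 𝔼 x₀).symm (u t)) := by
    intro s
    rw [map_smul, frameAt_coordAt ((chartAt 𝔼 x₀).map_target hy) X]
  exact ContinuousLinearMap.ext h2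

/-- The differential of a function in the frame of a chart consists of its partial derivatives. -/
theorem mfderiv_frameAt {f : M → ℝ} (hf : ContMDiff (𝓡 n) 𝓘(ℝ, ℝ) ∞ f) {x₀ : M} {y : 𝔼}
    (hy : y ∈ (chartAt 𝔼 x₀).target) (w : 𝔼) :
    mfderiv (𝓡 n) 𝓘(ℝ, ℝ) f ((chartAt 𝔼 x₀).symm y) (frameAt x₀ ((chartAt 𝔼 x₀).symm y) w) =
      fderiv ℝ (f ∘ (chartAt 𝔼 x₀).symm) y w := by
  have h1 := ((hf.mdifferentiable (by simp) ((chartAt 𝔼 x₀).symm y)).hasMFDerivAt).comp y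
    (hasMFDerivAt_chartAt_symm hy)
  obtain ⟨D, hD, hDw⟩ : ∃ D : 𝔼 →L[ℝ] ℝ, HasFDerivAt (f ∘ (chartAt 𝔼 x₀).symm) D y ∧
      D w = mfderiv (𝓡 n) 𝓘(ℝ, ℝ) f ((chartAt 𝔼 x₀).symm y)
        (frameAt x₀ ((chartAt 𝔼 x₀).symm y) w) :=
    ⟨_, hasMFDerivAt_iff_hasFDerivAt.1 h1, rfl⟩
  rw [hD.fderiv, hDw]

theorem contMDiffOn_frameAt (x₀ : M) (w : 𝔼) :
    ContMDiffOn (𝓡 n) (𝓡 n).tangent ∞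
      (fun q => (⟨q, frameAt x₀ q w⟩ : TangentBundle (𝓡 n) M)) (chartAt 𝔼 x₀).source := by
  have h := (trivializationAt 𝔼 (TangentSpace (𝓡 n)) x₀).contMDiffOn_section_baseSet_iff
    (IB := 𝓡 n) (n := ∞) (s := fun q : M => frameAt x₀ q w)
  rw [TangentBundle.trivializationAt_baseSet] at h
  refine h.2 ?_
  refine (contMDiffOn_const (c := w)).congr fun q hq => ?_
  exact coord_frameAt hq w

theorem contDiffOn_metric_frameAt (g : RiemannianMetric n M) (x₀ : M) (u w : 𝔼) :
    ContDiffOn ℝ ∞ (fun y => g.inner ((chartAt 𝔼 x₀).symm y)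
      (frameAt x₀ ((chartAt 𝔼 x₀).symm y) u) (frameAt x₀ ((chartAt 𝔼 x₀).symm y) w))
      (chartAt 𝔼 x₀).target := by
  have h1 : ContMDiffOn (𝓡 n) ((𝓡 n).prod 𝓘(ℝ, ℝ)) ∞
      (fun m : M => Bundle.TotalSpace.mk' ℝ (E := Bundle.Trivial M ℝ) m
        (g.inner m (frameAt x₀ m u) (frameAt x₀ m w))) (chartAt 𝔼 x₀).source := by
    apply ContMDiffOn.clm_bundle_apply₂ (F₁ := 𝔼) (F₂ := 𝔼)
    · exact g.contMDiff.contMDiffOn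
    · exact contMDiffOn_frameAt x₀ u
    · exact contMDiffOn_frameAt x₀ w
  have h2 : ContMDiffOn (𝓡 n) 𝓘(ℝ, ℝ) ∞
      (fun m : M => g.inner m (frameAt x₀ m u) (frameAt x₀ m w)) (chartAt 𝔼 x₀).source := by
    intro q hq
    have := h1 q hq
    simp only [Bundle.contMDiffWithinAt_totalSpace] at this
    exact this.2
  rw [← contMDiffOn_iff_contDiffOn]
  have h3 : ContMDiffOn (𝓡 n) (𝓡 n) ∞ (chartAt 𝔼 x₀).symm (chartAt 𝔼 x₀).target :=
    contMDiffOn_chart_symm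
  exact h2.comp h3 fun y hy => (chartAt 𝔼 x₀).map_target hy

/-- The metric `g` in the chart at `x₀`, as a family of bilinear forms on the coordinate space. -/
noncomputable def chartMetric (g : RiemannianMetric n M) (x₀ : M) (y : 𝔼) : 𝔼 →L[ℝ] 𝔼 →L[ℝ] ℝ :=
  ContinuousLinearMap.bilinearComp
    (show 𝔼 →L[ℝ] 𝔼 →L[ℝ] ℝ from g.inner ((chartAt 𝔼 x₀).symm y))
    (show 𝔼 →L[ℝ] 𝔼 from frameAt x₀ ((chartAt 𝔼 x₀).symm y))
    (show 𝔼 →L[ℝ] 𝔼 from frameAt x₀ ((chartAt 𝔼 x₀).symm y))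

theorem chartMetric_apply (g : RiemannianMetric n M) (x₀ : M) (y u w : 𝔼) :
    chartMetric g x₀ y u w = g.inner ((chartAt 𝔼 x₀).symm y)
      (frameAt x₀ ((chartAt 𝔼 x₀).symm y) u) (frameAt x₀ ((chartAt 𝔼 x₀).symm y) w) :=
  rfl

theorem contDiffOn_chartMetric (g : RiemannianMetric n M) (x₀ : M) :
    ContDiffOn ℝ ∞ (chartMetric g x₀) (chartAt 𝔼 x₀).target :=
  contDiffOn_clm_apply.2 fun u => contDiffOn_clm_apply.2 fun w =>
    contDiffOn_metric_frameAt g x₀ u w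

theorem chartMetric_symm (g : RiemannianMetric n M) (x₀ : M) (y u w : 𝔼) :
    chartMetric g x₀ y u w = chartMetric g x₀ y w u :=
  g.symm _ _ _

theorem chartMetric_pos (g : RiemannianMetric n M) {x₀ : M} {y : 𝔼}
    (hy : y ∈ (chartAt 𝔼 x₀).target) {w : 𝔼} (hw : w ≠ 0) : 0 < chartMetric g x₀ y w w := by
  refine g.pos _ _ fun h => hw ?_
  have h1 : frameAt x₀ ((chartAt 𝔼 x₀).symm y) w = frameAt x₀ ((chartAt 𝔼 x₀).symm y) 0 :=
    Eq.trans h (ContinuousLinearMap.map_zero _).symm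
  rw [← coord_frameAt ((chartAt 𝔼 x₀).map_target hy) w, h1, coord_frameAt]
  exact (chartAt 𝔼 x₀).map_target hy

/-- The equation `g (∇f, ·) = df` in coordinates. -/
theorem chartMetric_coordAt_gradient (g : RiemannianMetric n M) {f : M → ℝ}
    (hf : ContMDiff (𝓡 n) 𝓘(ℝ, ℝ) ∞ f) {x₀ : M} {y : 𝔼} (hy : y ∈ (chartAt 𝔼 x₀).target) :
    chartMetric g x₀ y (coordAt x₀ (gradient g f) ((chartAt 𝔼 x₀).symm y)) =
      fderiv ℝ (f ∘ (chartAt 𝔼 x₀).symm) y := by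
  refine ContinuousLinearMap.ext fun w => ?_
  rw [chartMetric_apply, frameAt_coordAt ((chartAt 𝔼 x₀).map_target hy), inner_gradient,
    mfderiv_frameAt hf hy]

end Coordinates

/-! ### Positive definite bilinear forms -/

section Linear

/-- A positive definite bilinear form identifies a finite-dimensional space with its dual. -/
theorem exists_continuousLinearEquiv_of_pos {E : Type*} [NormedAddCommGroup E] [NormedSpace ℝ E]
    [FiniteDimensional ℝ E] (G : E →L[ℝ] E →L[ℝ] ℝ) (hG : ∀ v, v ≠ 0 → 0 < G v v) :
    ∃ e : E ≃L[ℝ] (E →L[ℝ] ℝ), (e : E →L[ℝ] E →L[ℝ] ℝ) = G := by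
  have hinj : Function.Injective G.toLinearMap := by
    rw [injective_iff_map_eq_zero]
    intro w hw
    by_contra h
    have h2 : G w w = 0 := DFunLike.congr_fun hw w
    exact absurd h2 (hG w h).ne'
  have hd : Module.finrank ℝ E = Module.finrank ℝ (E →L[ℝ] ℝ) := by
    rw [← (LinearMap.toContinuousLinearMap (𝕜 := ℝ) (E := E) (F' := ℝ)).finrank_eq]
    exact (Subspace.dual_finrank_eq (K := ℝ) (V := E)).symm
  refine ⟨(LinearEquiv.ofBijective G.toLinearMap ⟨hinj,
    (LinearMap.injective_iff_surjective_of_finrank_eq_finrank hd).1 hinj⟩).toContinuousLinearEquiv,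
    ?_⟩
  ext v w
  rfl

/-- The solution `X` of the linear system `G y (X y) = d y` depends smoothly on `y` when the
positive definite form `G y` and the covector `d y` do. -/
theorem contDiffOn_of_bilin_eq {E : Type*} [NormedAddCommGroup E] [NormedSpace ℝ E]
    [FiniteDimensional ℝ E] {G : E → E →L[ℝ] E →L[ℝ] ℝ} {d : E → E →L[ℝ] ℝ} {X : E → E} {U : Set E}
    (hGc : ContDiffOn ℝ ∞ G U) (hd : ContDiffOn ℝ ∞ d U)
    (hG : ∀ y ∈ U, ∀ v, v ≠ 0 → 0 < G y v v) (hX : ∀ y ∈ U, G y (X y) = d y) :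
    ContDiffOn ℝ ∞ X U := by
  have : CompleteSpace E := FiniteDimensional.complete ℝ E
  have h1 : ContDiffOn ℝ ∞ (fun y => (G y).inverse (d y)) U := by
    refine ContDiffOn.clm_apply (fun y hy => ?_) hd
    obtain ⟨e, he⟩ := exists_continuousLinearEquiv_of_pos (G y) (hG y hy)
    have h2 := contDiffAt_map_inverse (𝕜 := ℝ) (n := ∞) e
    rw [he] at h2
    exact h2.comp_contDiffWithinAt y (hGc y hy)
  refine h1.congr fun y hy => ?_
  obtain ⟨e, he⟩ := exists_continuousLinearEquiv_of_pos (G y) (hG y hy)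
  rw [← hX y hy, ← he, ContinuousLinearMap.inverse_equiv]
  simp

/-- The spectral theorem for an operator that is self-adjoint with respect to a positive definite
symmetric bilinear form. -/
theorem exists_eigenbasis {E : Type*} [AddCommGroup E] [Module ℝ E] [FiniteDimensional ℝ E]
    (G : E →ₗ[ℝ] E →ₗ[ℝ] ℝ) (hs : ∀ u v, G u v = G v u) (hp : ∀ v, v ≠ 0 → 0 < G v v)
    (L : E →ₗ[ℝ] E) (hL : ∀ u v, G (L u) v = G u (L v)) :
    ∃ (b : Module.Basis (Fin (Module.finrank ℝ E)) ℝ E) (μ : Fin (Module.finrank ℝ E) → ℝ),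
      ∀ i, L (b i) = μ i • b i := by
  let core : InnerProductSpace.Core ℝ E :=
    { inner := fun u v => G u v
      conj_inner_symm := fun u v => by simpa using hs v u
      re_inner_nonneg := fun v => by
        by_cases h : v = 0
        · simp [h]
        · simpa using (hp v h).le
      add_left := fun u v w => by simp
      smul_left := fun u v r => by simp
      definite := fun v hv => by
        by_contra h
        exact (hp v h).ne' hv }
  let _ : NormedAddCommGroup E := core.toNormedAddCommGroup
  let _ : InnerProductSpace ℝ E := InnerProductSpace.ofCore core.toCore
  have hsym : L.IsSymmetric := hL
  refine ⟨(hsym.eigenvectorBasis rfl).toBasis, hsym.eigenvalues rfl, fun i => ?_⟩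
  rw [OrthonormalBasis.coe_toBasis]
  simp

end Linear

/-! ### Eigenspaces of a diagonal operator -/

section Linear

variable {E : Type*} [AddCommGroup E] [Module ℝ E] {ι : Type*}
  {b : Module.Basis ι ℝ E} {μ : ι → ℝ}

/-- The sum of the eigenspaces of a diagonal operator for the positive eigenvalues is the space
fixed by the coordinate projection to these. -/
theorem mem_iSup_eigenspace_pos_iff [Fintype ι] {L P : E →ₗ[ℝ] E} (hL : ∀ i, L (b i) = μ i • b i)
    (hP : ∀ i, P (b i) = if 0 < μ i then b i else 0) (v : E) :
    v ∈ (⨆ c : {c : ℝ // 0 < c}, Module.End.eigenspace L (c : ℝ)) ↔ P v = v := by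
  constructor
  · intro hv
    suffices h : (⨆ c : {c : ℝ // 0 < c}, Module.End.eigenspace L (c : ℝ)) ≤
        LinearMap.eqLocus P LinearMap.id from h hv
    refine iSup_le fun c w hw => ?_
    rw [Module.End.mem_eigenspace_iff] at hw
    have hsum := b.sum_repr w
    have h1 : ∀ i, (μ i - c) * b.repr w i = 0 := by
      intro i
      have h2 : L w = ∑ i, (b.repr w i * μ i) • b i := by
        conv_lhs => rw [← hsum, map_sum]
        exact Finset.sum_congr rfl fun j _ => by rw [map_smul, hL, smul_smul]
      have h3 : b.repr (L w) i = b.repr w i * μ i := by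
        rw [h2]
        exact b.repr_sum_self (fun i => b.repr w i * μ i) ▸ rfl
      rw [hw, map_smul, Finsupp.smul_apply, smul_eq_mul] at h3
      linarith
    rw [LinearMap.mem_eqLocus, LinearMap.id_apply]
    conv_lhs => rw [← hsum]
    conv_rhs => rw [← hsum]
    rw [map_sum]
    refine Finset.sum_congr rfl fun i _ => ?_
    rw [map_smul, hP]
    split_ifs with h
    · rfl
    · rcases mul_eq_zero.1 (h1 i) with h2 | h2
      · exact absurd (by rw [sub_eq_zero.1 h2]; exact c.2) h
      · rw [h2, zero_smul, zero_smul]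
  · intro hv
    rw [← hv, ← b.sum_repr v, map_sum]
    refine Submodule.sum_mem _ fun i _ => ?_
    rw [map_smul, hP]
    split_ifs with h
    · refine Submodule.smul_mem _ _ (Submodule.mem_iSup_of_mem ⟨μ i, h⟩ ?_)
      exact Module.End.mem_eigenspace_iff.2 (hL i)
    · rw [smul_zero]
      exact Submodule.zero_mem _

end Linear

/-! ### The gradient vector field and its linearization -/

section Gradient

variable {n : ℕ} {M : Type*} [TopologicalSpace M] [ChartedSpace (EuclideanSpace ℝ (Fin n)) M]
  [IsManifold (𝓡 n) ∞ M]

local notation "𝔼" => EuclideanSpace ℝ (Fin n)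

/-- The vector field `X` in the chart at `x₀`, as a map on the coordinate space. -/
noncomputable def chartField (X : (p : M) → TangentSpace (𝓡 n) p) (x₀ : M) (y : 𝔼) : 𝔼 :=
  coordAt x₀ X ((chartAt 𝔼 x₀).symm y)

theorem contDiffOn_comp_chartAt_symm {f : M → ℝ} (hf : ContMDiff (𝓡 n) 𝓘(ℝ, ℝ) ∞ f) (x₀ : M) :
    ContDiffOn ℝ ∞ (f ∘ (chartAt 𝔼 x₀).symm) (chartAt 𝔼 x₀).target := by
  rw [← contMDiffOn_iff_contDiffOn]
  have h3 : ContMDiffOn (𝓡 n) (𝓡 n) ∞ (chartAt 𝔼 x₀).symm (chartAt 𝔼 x₀).target :=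
    contMDiffOn_chart_symm
  exact hf.comp_contMDiffOn h3

theorem contDiffOn_chartField_gradient (g : RiemannianMetric n M) {f : M → ℝ}
    (hf : ContMDiff (𝓡 n) 𝓘(ℝ, ℝ) ∞ f) (x₀ : M) :
    ContDiffOn ℝ ∞ (chartField (gradient g f) x₀) (chartAt 𝔼 x₀).target :=
  contDiffOn_of_bilin_eq (contDiffOn_chartMetric g x₀)
    ((contDiffOn_comp_chartAt_symm hf x₀).fderiv_of_isOpen (chartAt 𝔼 x₀).open_target (by simp))
    (fun _ hy _ hv => chartMetric_pos g hy hv) fun _ hy => chartMetric_coordAt_gradient g hf hy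

/-- A vector field is smooth if it is smooth in the preferred charts. -/
theorem contMDiff_of_contDiffOn_chartField {X : (p : M) → TangentSpace (𝓡 n) p}
    (hX : ∀ x₀, ContDiffOn ℝ ∞ (chartField X x₀) (chartAt 𝔼 x₀).target) :
    ContMDiff (𝓡 n) (𝓡 n).tangent ∞ (fun q => (⟨q, X q⟩ : TangentBundle (𝓡 n) M)) := by
  intro x₀
  have h := (trivializationAt 𝔼 (TangentSpace (𝓡 n)) x₀).contMDiffOn_section_baseSet_iff
    (IB := 𝓡 n) (n := ∞) (s := X)
  rw [TangentBundle.trivializationAt_baseSet] at h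
  have h1 : ContMDiffOn (𝓡 n) 𝓘(ℝ, 𝔼) ∞ (coordAt x₀ X) (chartAt 𝔼 x₀).source := by
    have h2 : ContMDiffOn (𝓡 n) (𝓡 n) ∞ (chartAt 𝔼 x₀) (chartAt 𝔼 x₀).source := contMDiffOn_chart
    refine ((contMDiffOn_iff_contDiffOn.2 (hX x₀)).comp h2
      fun q hq => (chartAt 𝔼 x₀).map_source hq).congr fun q hq => ?_
    simp only [Function.comp_apply, chartField]
    rw [(chartAt 𝔼 x₀).left_inv hq]
  exact (h.2 h1).contMDiffAt ((chartAt 𝔼 x₀).open_source.mem_nhds (mem_chart_source 𝔼 x₀))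

theorem coordAt_neg {X : (p : M) → TangentSpace (𝓡 n) p} {x₀ q : M}
    (hq : q ∈ (chartAt 𝔼 x₀).source) : coordAt x₀ (fun p => -X p) q = -coordAt x₀ X q := by
  have h1 : ∀ Y : (p : M) → TangentSpace (𝓡 n) p, coordAt x₀ Y q =
      (trivializationAt 𝔼 (TangentSpace (𝓡 n)) x₀).continuousLinearMapAt ℝ q (Y q) := fun Y =>
    (Bundle.Trivialization.continuousLinearMapAt_apply_of_mem ℝ _
      (mem_baseSet_trivializationAt hq) _).symm
  rw [h1, h1, map_neg]

/-- The linearization of a vector field is its derivative in the preferred chart. -/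
theorem linearization_eq_fderiv {X : (p : M) → TangentSpace (𝓡 n) p} {x : M}
    (hX : DifferentiableAt ℝ (chartField X x) (chartAt 𝔼 x x)) :
    linearization X x = fderiv ℝ (chartField X x) (chartAt 𝔼 x x) := by
  have h1 : MDifferentiableAt (𝓡 n) 𝓘(ℝ, 𝔼) (coordAt x X) x := by
    have h2 : MDifferentiableAt (𝓡 n) (𝓡 n) (chartAt 𝔼 x) x :=
      mdifferentiableAt_atlas (ChartedSpace.chart_mem_atlas x) (mem_chart_source 𝔼 x)
    refine (hX.mdifferentiableAt.comp x h2).congr_of_eventuallyEq ?_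
    filter_upwards [(chartAt 𝔼 x).open_source.mem_nhds (mem_chart_source 𝔼 x)] with q hq
    simp only [Function.comp_apply, chartField]
    rw [(chartAt 𝔼 x).left_inv hq]
  have h3 := h1.mfderiv
  rw [ModelWithCorners.range_eq_univ, fderivWithin_univ] at h3
  exact h3

theorem gradient_eq_zero_of_isCritical (g : RiemannianMetric n M) {f : M → ℝ} {x : M}
    (hx : IsCritical (n := n) f x) : gradient g f x = 0 := by
  by_contra h
  have h1 := g.pos x _ h
  rw [inner_gradient, hx] at h1
  exact lt_irrefl _ h1

theorem chartField_eq_zero {X : (p : M) → TangentSpace (𝓡 n) p} {x : M} (hx : X x = 0) :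
    chartField X x (chartAt 𝔼 x x) = 0 := by
  have hxs : x ∈ (chartAt 𝔼 x).source := mem_chart_source 𝔼 x
  rw [chartField, (chartAt 𝔼 x).left_inv hxs]
  have h1 : coordAt x X x =
      (trivializationAt 𝔼 (TangentSpace (𝓡 n)) x).continuousLinearMapAt ℝ x (X x) :=
    (Bundle.Trivialization.continuousLinearMapAt_apply_of_mem ℝ _
      (mem_baseSet_trivializationAt hxs) _).symm
  rw [h1, hx]
  exact ContinuousLinearMap.map_zero _

/-- At a critical point, the linearized gradient represents the Hessian with respect to the
metric. -/
theorem chartMetric_fderiv_chartField_gradient (g : RiemannianMetric n M) {f : M → ℝ}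
    (hf : ContMDiff (𝓡 n) 𝓘(ℝ, ℝ) ∞ f) {x : M} (hx : IsCritical (n := n) f x) (v : 𝔼) :
    chartMetric g x (chartAt 𝔼 x x)
        (fderiv ℝ (chartField (gradient g f) x) (chartAt 𝔼 x x) v) =
      fderiv ℝ (fderiv ℝ (f ∘ (chartAt 𝔼 x).symm)) (chartAt 𝔼 x x) v := by
  have hyt : chartAt 𝔼 x x ∈ (chartAt 𝔼 x).target :=
    (chartAt 𝔼 x).map_source (mem_chart_source 𝔼 x)
  have hnhds := (chartAt 𝔼 x).open_target.mem_nhds hyt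
  have hG : DifferentiableAt ℝ (chartMetric g x) (chartAt 𝔼 x x) :=
    ((contDiffOn_chartMetric g x).contDiffAt hnhds).differentiableAt (by simp)
  have hX : DifferentiableAt ℝ (chartField (gradient g f) x) (chartAt 𝔼 x x) :=
    ((contDiffOn_chartField_gradient g hf x).contDiffAt hnhds).differentiableAt (by simp)
  have h1 := hG.hasFDerivAt.clm_apply hX.hasFDerivAt
  rw [chartField_eq_zero (gradient_eq_zero_of_isCritical g hx), map_zero, add_zero] at h1
  have h2 : (fun y => chartMetric g x y (chartField (gradient g f) x y)) =ᶠ[𝓝 (chartAt 𝔼 x x)]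
      fderiv ℝ (f ∘ (chartAt 𝔼 x).symm) := by
    filter_upwards [hnhds] with y hy
    exact chartMetric_coordAt_gradient g hf hy
  rw [← h2.fderiv_eq, h1.fderiv]
  rfl

/-- At a nondegenerate critical point, the linearized gradient is diagonalizable with nonzero real
eigenvalues. -/
theorem exists_eigenbasis_chartField_gradient (g : RiemannianMetric n M) {f : M → ℝ}
    (hf : IsMorse n f) {x : M} (hx : IsCritical (n := n) f x) :
    ∃ (b : Module.Basis (Fin (Module.finrank ℝ 𝔼)) ℝ 𝔼) (μ : Fin (Module.finrank ℝ 𝔼) → ℝ),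
      (∀ i, μ i ≠ 0) ∧ ∀ i, fderiv ℝ (chartField (gradient g f) x) (chartAt 𝔼 x x) (b i) =
        μ i • b i := by
  have hyt : chartAt 𝔼 x x ∈ (chartAt 𝔼 x).target :=
    (chartAt 𝔼 x).map_source (mem_chart_source 𝔼 x)
  have hnhds := (chartAt 𝔼 x).open_target.mem_nhds hyt
  have hess := chartMetric_fderiv_chartField_gradient g hf.smooth hx
  have hsym : IsSymmSndFDerivAt ℝ (f ∘ (chartAt 𝔼 x).symm) (chartAt 𝔼 x x) :=
    ((contDiffOn_comp_chartAt_symm hf.smooth x).contDiffAt hnhds).isSymmSndFDerivAt (by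
      rw [minSmoothness_of_isRCLikeNormedField]
      exact ENat.LEInfty.out)
  let G : 𝔼 →ₗ[ℝ] 𝔼 →ₗ[ℝ] ℝ :=
    ContinuousLinearMap.coeLM ℝ ∘ₗ (chartMetric g x (chartAt 𝔼 x x)).toLinearMap
  obtain ⟨b, μ, hb⟩ := exists_eigenbasis G (fun u v => chartMetric_symm g x _ u v)
    (fun v hv => chartMetric_pos g hyt hv)
    (fderiv ℝ (chartField (gradient g f) x) (chartAt 𝔼 x x)).toLinearMap (fun u v => by
      have h1 := DFunLike.congr_fun (hess u) v
      have h2 := DFunLike.congr_fun (hess v) u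
      rw [chartMetric_symm] at h2
      exact h1.trans ((hsym u v).trans h2.symm))
  refine ⟨b, μ, fun i hi => b.ne_zero i ?_, hb⟩
  refine hf.nondegenerate x hx (b i) fun η => ?_
  have h1 : fderiv ℝ (fderiv ℝ (f ∘ (chartAt 𝔼 x).symm)) (chartAt 𝔼 x x) (b i) = 0 := by
    have h2 : fderiv ℝ (chartField (gradient g f) x) (chartAt 𝔼 x x) (b i) = μ i • b i := hb i
    rw [← hess, h2, hi, zero_smul, map_zero]
  exact DFunLike.congr_fun h1 η

end Gradient

/-! ### The flow of a vector field on a closed manifold -/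

section Flow

variable {n : ℕ} {M : Type*} [TopologicalSpace M] [ChartedSpace (EuclideanSpace ℝ (Fin n)) M]
  [IsManifold (𝓡 n) ∞ M] {X : (p : M) → TangentSpace (𝓡 n) p}

local notation "𝔼" => EuclideanSpace ℝ (Fin n)

/-- The local flow of a smooth vector field near a point `p`, together with its derivative at `p`
on eigenvectors of the linearized field when `p` is a zero. -/
theorem exists_local_flow (hX : ∀ x₀, ContDiffOn ℝ ∞ (chartField X x₀) (chartAt 𝔼 x₀).target)
    (p : M) :
    ∃ T > (0 : ℝ), ∃ V, IsOpen V ∧ p ∈ V ∧ ∃ θ : ℝ → M → M,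
      (∀ t, ContMDiffOn (𝓡 n) (𝓡 n) ∞ (θ t) V) ∧
      ContinuousOn (fun z : ℝ × M => θ z.1 z.2) (univ ×ˢ V) ∧
      (∀ q ∈ V, θ 0 q = q) ∧
      (∀ q ∈ V, IsMIntegralCurveOn (I := 𝓡 n) (fun t => θ t q) X (Ioo (-T) T)) ∧
      (X p = 0 → ∀ (μ : ℝ) (v : 𝔼), fderiv ℝ (chartField X p) (chartAt 𝔼 p p) v = μ • v →
        ∀ t ∈ Ioo (-T) T,
          fderiv ℝ (chartAt 𝔼 p ∘ θ t ∘ (chartAt 𝔼 p).symm) (chartAt 𝔼 p p) v =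
            Real.exp (μ * t) • v) := by
  set c := chartAt 𝔼 p with hc
  have hps : p ∈ c.source := mem_chart_source 𝔼 p
  have hpt : c p ∈ c.target := c.map_source hps
  have hnhds := c.open_target.mem_nhds hpt
  obtain ⟨F, hF, hFX⟩ := exists_contDiff_eventuallyEq (hX p) hnhds
  obtain ⟨T, hT, V', hV'o, hpV', Φ, hΦ, hΦc, hΦ0, hΦU, hΦd, hΦe⟩ :=
    exists_smooth_local_flow hF (c p) (Filter.inter_mem hnhds hFX)
  have hsrc : ContMDiffOn (𝓡 n) (𝓡 n) ∞ c c.source := contMDiffOn_chart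
  have htgt : ContMDiffOn (𝓡 n) (𝓡 n) ∞ c.symm c.target := contMDiffOn_chart_symm
  have hmaps : MapsTo c (c.source ∩ c ⁻¹' V') V' := fun q hq => hq.2
  refine ⟨T, hT, c.source ∩ c ⁻¹' V', c.isOpen_inter_preimage hV'o, ⟨hps, hpV'⟩,
    fun t q => c.symm (Φ t (c q)), fun t => ?_, ?_, fun q hq => ?_, fun q hq => ?_, ?_⟩
  · have h1 : ContMDiffOn (𝓡 n) (𝓡 n) ∞ (Φ t ∘ c) (c.source ∩ c ⁻¹' V') :=
      (contMDiffOn_iff_contDiffOn.2 (hΦ t)).comp (hsrc.mono inter_subset_left) hmaps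
    exact htgt.comp h1 fun q hq => (hΦU _ hq.2 t).1
  · have h1 : ContinuousOn (fun z : ℝ × M => (z.1, c z.2)) (univ ×ˢ (c.source ∩ c ⁻¹' V')) :=
      continuousOn_fst.prodMk (c.continuousOn.comp continuousOn_snd fun z hz => hz.2.1)
    have h2 := hΦc.comp h1 fun z hz => ⟨mem_univ _, hz.2.2⟩
    exact c.continuousOn_symm.comp h2 fun z hz => (hΦU _ hz.2.2 z.1).1
  · simp only
    rw [hΦ0 _ hq.2, c.left_inv hq.1]
  · intro t ht
    refine HasMFDerivAt.hasMFDerivWithinAt ?_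
    have h1 := hΦd _ hq.2 t ht
    rw [show F (Φ t (c q)) = chartField X p (Φ t (c q)) from (hΦU _ hq.2 t).2] at h1
    exact hasMFDerivAt_chartAt_symm_comp (u := fun s => Φ s (c q)) (hΦU _ hq.2 t).1 h1
  · intro hp μ v hv t ht
    have h1 : c ∘ (fun q => c.symm (Φ t (c q))) ∘ c.symm =ᶠ[𝓝 (c p)] Φ t := by
      filter_upwards [hnhds, hV'o.mem_nhds hpV'] with y hy hyV
      simp only [Function.comp_apply]
      rw [c.right_inv hy, c.right_inv (hΦU y hyV t).1]
    rw [h1.fderiv_eq]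
    refine hΦe ?_ μ v ?_ t ht
    · rw [hFX.eq_of_nhds]
      exact chartField_eq_zero hp
    · rw [hFX.fderiv_eq]
      exact hv

/-- The flow of a smooth vector field on a closed manifold: complete, and smooth for small times.
Its derivative at a zero `x` of the field acts on the eigenvectors of the linearization by
exponentials. -/
theorem exists_flow [CompactSpace M] [T2Space M]
    (hX : ∀ x₀, ContDiffOn ℝ ∞ (chartField X x₀) (chartAt 𝔼 x₀).target) (x : M) :
    ∃ ε > (0 : ℝ), ∃ θ : ℝ → M → M,
      (∀ q, IsTrajectory X q (fun t => θ t q)) ∧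
      (∀ q γ, IsTrajectory X q γ → γ = fun t => θ t q) ∧
      (∀ s t q, θ (s + t) q = θ s (θ t q)) ∧
      (∀ t ∈ Ioo (-ε) ε, ContMDiff (𝓡 n) (𝓡 n) ∞ (θ t)) ∧
      (∀ t ∈ Ioo (-ε) ε, ∀ q, ContinuousAt (fun z : ℝ × M => θ z.1 z.2) (t, q)) ∧
      (X x = 0 → ∀ (μ : ℝ) (v : 𝔼), fderiv ℝ (chartField X x) (chartAt 𝔼 x x) v = μ • v →
        ∀ t ∈ Ioo (-ε) ε,
          fderiv ℝ (chartAt 𝔼 x ∘ θ t ∘ (chartAt 𝔼 x).symm) (chartAt 𝔼 x x) v =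
            Real.exp (μ * t) • v) := by
  have : IsManifold (𝓡 n) 1 M := IsManifold.of_le (n := ∞) (by simp)
  have hsm : ContMDiff (𝓡 n) (𝓡 n).tangent 1 (fun q => (⟨q, X q⟩ : TangentBundle (𝓡 n) M)) :=
    (contMDiff_of_contDiffOn_chartField hX).of_le (by simp)
  choose T hT V hVo hpV φ hφ hφc hφ0 hφX hφe using exists_local_flow hX
  obtain ⟨s, hs⟩ := isCompact_univ.elim_finite_subcover V hVo
    (fun q _ => mem_iUnion.2 ⟨q, hpV q⟩)
  -- a time below all the local times of a finite cover
  obtain ⟨ε, hε, hεx, hεs⟩ : ∃ ε > 0, ε ≤ T x ∧ ∀ p ∈ s, ε ≤ T p := by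
    classical
    have hne : (insert x s).Nonempty := Finset.insert_nonempty x s
    refine ⟨(insert x s).inf' hne T, (Finset.lt_inf'_iff hne).2 fun p _ => hT p,
      Finset.inf'_le T (Finset.mem_insert_self x s),
      fun p hp => Finset.inf'_le T (Finset.mem_insert_of_mem hp)⟩
  have hcov : ∀ q, ∃ p ∈ s, q ∈ V p := fun q => by
    simpa using hs (mem_univ q)
  have hex := exists_isMIntegralCurve_of_isMIntegralCurveOn hsm hε fun q => by
    obtain ⟨p, hp, hq⟩ := hcov q
    exact ⟨fun t => φ p t q, hφ0 p q hq, (hφX p q hq).mono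
      (Ioo_subset_Ioo (neg_le_neg (hεs p hp)) (hεs p hp))⟩
  choose Γ hΓ0 hΓ using hex
  have huniq : ∀ q γ, IsTrajectory X q γ → γ = Γ q := fun q γ hγ =>
    isMIntegralCurve_Ioo_eq_of_contMDiff_boundaryless (t₀ := 0) hsm hγ.1 (hΓ q)
      (hγ.2.trans (hΓ0 q).symm)
  -- the local flows are pieces of the global one
  have hloc : ∀ p, ∀ q ∈ V p, ∀ t ∈ Ioo (-T p) (T p), Γ q t = φ p t q := fun p q hq t ht =>
    isMIntegralCurveOn_Ioo_eqOn_of_contMDiff_boundaryless (t₀ := 0)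
      ⟨neg_lt_zero.2 (hT p), hT p⟩ hsm ((hΓ q).isMIntegralCurveOn _) (hφX p q hq)
      ((hΓ0 q).trans (hφ0 p q hq).symm) ht
  have hlocε : ∀ p ∈ s, ∀ q ∈ V p, ∀ t ∈ Ioo (-ε) ε, Γ q t = φ p t q := fun p hp q hq t ht =>
    hloc p q hq t (Ioo_subset_Ioo (neg_le_neg (hεs p hp)) (hεs p hp) ht)
  refine ⟨ε, hε, fun t q => Γ q t, fun q => ⟨hΓ q, hΓ0 q⟩, huniq, fun r t q => ?_,
    fun t ht q => ?_, fun t ht q => ?_, fun hx μ v hv t ht => ?_⟩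
  · have h1 : IsTrajectory X (Γ q t) (Γ q ∘ (· + t)) :=
      ⟨(hΓ q).comp_add t, by simp⟩
    exact congrFun (huniq _ _ h1) r
  · obtain ⟨p, hp, hq⟩ := hcov q
    refine ((hφ p t).contMDiffAt ((hVo p).mem_nhds hq)).congr_of_eventuallyEq ?_
    filter_upwards [(hVo p).mem_nhds hq] with q' hq'
    exact hlocε p hp q' hq' t ht
  · obtain ⟨p, hp, hq⟩ := hcov q
    have hn : Ioo (-ε) ε ×ˢ V p ∈ 𝓝 (t, q) :=
      prod_mem_nhds (Ioo_mem_nhds ht.1 ht.2) ((hVo p).mem_nhds hq)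
    refine ((hφc p).continuousAt (Filter.mem_of_superset hn ?_)).congr ?_
    · exact prod_mono_left (subset_univ _)
    · filter_upwards [hn] with z hz
      exact (hlocε p hp z.2 hz.2 z.1 hz.1).symm
  · have ht' : t ∈ Ioo (-T x) (T x) := Ioo_subset_Ioo (neg_le_neg hεx) hεx ht
    rw [← hφe x hx μ v hv t ht']
    refine congrFun (congrArg DFunLike.coe (Filter.EventuallyEq.fderiv_eq ?_)) v
    have hpt := (chartAt 𝔼 x).map_source (mem_chart_source 𝔼 x)
    have h1 : (chartAt 𝔼 x).symm ⁻¹' V x ∈ 𝓝 (chartAt 𝔼 x x) := by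
      refine ((chartAt 𝔼 x).continuousAt_symm hpt).preimage_mem_nhds ?_
      rw [(chartAt 𝔼 x).left_inv (mem_chart_source 𝔼 x)]
      exact (hVo x).mem_nhds (hpV x)
    filter_upwards [h1] with y hy
    simp only [Function.comp_apply]
    rw [hloc x _ hy t ht']

end Flow

/-! ### Descent along negative gradient trajectories -/

section Descent

variable {n : ℕ} {M : Type*} [TopologicalSpace M] [ChartedSpace (EuclideanSpace ℝ (Fin n)) M]
  {f : M → ℝ}

local notation "𝔼" => EuclideanSpace ℝ (Fin n)

theorem hasDerivAt_comp_trajectory (hf : ContMDiff (𝓡 n) 𝓘(ℝ, ℝ) ∞ f)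
    {X : (p : M) → TangentSpace (𝓡 n) p} {q : M} {γ : ℝ → M} (hγ : IsTrajectory X q γ) (t : ℝ) :
    HasDerivAt (f ∘ γ) (mfderiv (𝓡 n) 𝓘(ℝ, ℝ) f (γ t) (X (γ t))) t := by
  have h1 := ((hf.mdifferentiable (by simp) (γ t)).hasMFDerivAt).comp t (hγ.1 t)
  obtain ⟨D, hD, hD1⟩ : ∃ D : ℝ →L[ℝ] ℝ, HasFDerivAt (f ∘ γ) D t ∧
      D 1 = mfderiv (𝓡 n) 𝓘(ℝ, ℝ) f (γ t) ((1 : ℝ) • X (γ t)) :=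
    ⟨_, hasMFDerivAt_iff_hasFDerivAt.1 h1, rfl⟩
  rw [one_smul] at hD1
  rw [← hD1]
  exact hD.hasDerivAt

theorem isTrajectory_const {X : (p : M) → TangentSpace (𝓡 n) p} {x : M} (hx : X x = 0) :
    IsTrajectory X x (fun _ => x) :=
  ⟨isMIntegralCurve_const hx, rfl⟩

variable [IsManifold (𝓡 n) ∞ M]

theorem mfderiv_negGradient (g : RiemannianMetric n M) (f : M → ℝ) (q : M) :
    mfderiv (𝓡 n) 𝓘(ℝ, ℝ) f q (negGradient g f q) =
      -(g.inner q (gradient g f q) (gradient g f q)) := by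
  rw [inner_gradient, negGradient]
  exact ContinuousLinearMap.map_neg _ _

theorem inner_gradient_self_nonneg (g : RiemannianMetric n M) (f : M → ℝ) (q : M) :
    0 ≤ g.inner q (gradient g f q) (gradient g f q) := by
  by_cases h : gradient g f q = 0
  · rw [h]
    exact (ContinuousLinearMap.map_zero _).ge
  · exact (g.pos q _ h).le

theorem antitone_comp_trajectory (g : RiemannianMetric n M) (hf : ContMDiff (𝓡 n) 𝓘(ℝ, ℝ) ∞ f)
    {q : M} {γ : ℝ → M} (hγ : IsTrajectory (negGradient g f) q γ) : Antitone (f ∘ γ) := by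
  refine antitone_of_deriv_nonpos
    (fun t => (hasDerivAt_comp_trajectory hf hγ t).differentiableAt) fun t => ?_
  rw [(hasDerivAt_comp_trajectory hf hγ t).deriv, mfderiv_negGradient]
  exact neg_nonpos.2 (inner_gradient_self_nonneg g f _)

/-- If `f` takes the same value at two times of a trajectory, the trajectory passes a zero of the
gradient in between. -/
theorem exists_gradient_eq_zero (g : RiemannianMetric n M) (hf : ContMDiff (𝓡 n) 𝓘(ℝ, ℝ) ∞ f)
    {q : M} {γ : ℝ → M} (hγ : IsTrajectory (negGradient g f) q γ) {a b : ℝ} (hab : a < b)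
    (h : f (γ a) = f (γ b)) : ∃ t ∈ Ioo a b, gradient g f (γ t) = 0 := by
  have hd := hasDerivAt_comp_trajectory hf hγ
  obtain ⟨t, ht, h0⟩ := exists_hasDerivAt_eq_zero hab
    (fun s _ => (hd s).continuousAt.continuousWithinAt) h fun s _ => hd s
  refine ⟨t, ht, ?_⟩
  by_contra hne
  rw [mfderiv_negGradient] at h0
  exact (g.pos _ _ hne).ne' (neg_eq_zero.1 h0)

end Descent

/-! ### Limit sets and convergence -/

section LimitSets

variable {M : Type*} [TopologicalSpace M] [CompactSpace M] [FirstCountableTopology M] [T2Space M]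

/-- For a flow `θ` fixing `x`, a trajectory has the single `ω`-limit point `x` exactly when the
iterates of the time-`τ` map converge to `x`. -/
theorem omegaLimit_eq_singleton_iff {θ : ℝ → M → M} (hθ0 : ∀ q, θ 0 q = q)
    (hθ : ∀ s t q, θ (s + t) q = θ s (θ t q)) {x : M} (hx : ∀ t, θ t x = x) {τ : ℝ} (hτ : 0 < τ)
    (hc : ∀ t ∈ Icc 0 τ, ContinuousAt (fun z : ℝ × M => θ z.1 z.2) (t, x)) (q : M) :
    omegaLimit (fun t => θ t q) = {x} ↔ q ∈ stableSet (θ τ) x := by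
  have hiter : ∀ k : ℕ, (θ τ)^[k] q = θ (k * τ) q := by
    intro k
    induction k with
    | zero => simp [hθ0]
    | succ k ih =>
      rw [Function.iterate_succ_apply', ih, ← hθ]
      congr 1
      push_cast
      ring
  have hlin : Tendsto (fun k : ℕ => (k : ℝ) * τ) atTop atTop :=
    tendsto_natCast_atTop_atTop.atTop_mul_const hτ
  constructor
  · intro h
    refine isCompact_univ.tendsto_nhds_of_unique_mapClusterPt (Eventually.of_forall fun _ =>
      mem_univ _) fun p _ hcl => ?_
    obtain ⟨ψ, hψ, hlim⟩ := hcl.tendsto_subseq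
    have hp : p ∈ omegaLimit (fun t => θ t q) := by
      refine ⟨fun k => (ψ k : ℕ) * τ, hlin.comp hψ.tendsto_atTop, ?_⟩
      refine hlim.congr fun k => ?_
      exact hiter _
    rw [h] at hp
    exact hp
  · intro h
    -- convergence of the iterates improves to convergence along all times, since the trajectories
    -- starting close to `x` stay close to `x` during `[0, τ]`
    have hfull : Tendsto (fun t => θ t q) atTop (𝓝 x) := by
      intro O hO
      have h1 : ∀ᶠ p in 𝓝 x, ∀ t ∈ Icc 0 τ, θ t p ∈ O := by
        refine isCompact_Icc.eventually_forall_of_forall_eventually fun t ht => ?_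
        have h2 : Tendsto (fun z : M × ℝ => θ z.2 z.1) (𝓝 (x, t)) (𝓝 x) := by
          have h3 := (hc t ht).tendsto
          simp only [hx] at h3
          exact h3.comp (continuous_swap.tendsto (x, t))
        exact h2.eventually hO
      have h2 : ∀ᶠ t : ℝ in atTop, ∀ s ∈ Icc 0 τ, θ s ((θ τ)^[⌊t / τ⌋₊] q) ∈ O :=
        (tendsto_nat_floor_atTop.comp (tendsto_id.atTop_div_const hτ)).eventually
          (Tendsto.eventually h h1)
      change ∀ᶠ t in atTop, θ t q ∈ O
      filter_upwards [h2, eventually_ge_atTop 0] with t ht ht0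
      have h3 := Nat.floor_le (div_nonneg ht0 hτ.le)
      have h4 := Nat.lt_floor_add_one (t / τ)
      rw [le_div_iff₀ hτ] at h3
      rw [div_lt_iff₀ hτ] at h4
      have h5 := ht (t - ⌊t / τ⌋₊ * τ) ⟨by linarith, by linarith⟩
      rw [hiter, ← hθ, sub_add_cancel] at h5
      exact h5
    refine eq_singleton_iff_unique_mem.2 ⟨⟨fun k => k, tendsto_natCast_atTop_atTop,
      hfull.comp tendsto_natCast_atTop_atTop⟩, ?_⟩
    rintro p ⟨t, ht, hp⟩
    exact tendsto_nhds_unique hp (hfull.comp ht)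

end LimitSets

/-! ### The stable manifold of a critical point -/

section Stable

variable {n : ℕ} {M : Type*} [TopologicalSpace M] [ChartedSpace (EuclideanSpace ℝ (Fin n)) M]
  [IsManifold (𝓡 n) ∞ M]

local notation "𝔼" => EuclideanSpace ℝ (Fin n)

theorem contDiffOn_chartField_negGradient (g : RiemannianMetric n M) {f : M → ℝ}
    (hf : ContMDiff (𝓡 n) 𝓘(ℝ, ℝ) ∞ f) (x₀ : M) :
    ContDiffOn ℝ ∞ (chartField (negGradient g f) x₀) (chartAt 𝔼 x₀).target :=
  (contDiffOn_chartField_gradient g hf x₀).neg.congr fun _ hy =>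
    coordAt_neg ((chartAt 𝔼 x₀).map_target hy)

theorem fderiv_chartField_negGradient (g : RiemannianMetric n M) (f : M → ℝ) (x : M) :
    fderiv ℝ (chartField (negGradient g f) x) (chartAt 𝔼 x x) =
      -fderiv ℝ (chartField (gradient g f) x) (chartAt 𝔼 x x) := by
  have hyt : chartAt 𝔼 x x ∈ (chartAt 𝔼 x).target :=
    (chartAt 𝔼 x).map_source (mem_chart_source 𝔼 x)
  have h1 : chartField (negGradient g f) x =ᶠ[𝓝 (chartAt 𝔼 x x)]
      -chartField (gradient g f) x := by
    filter_upwards [(chartAt 𝔼 x).open_target.mem_nhds hyt] with y hy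
    exact coordAt_neg ((chartAt 𝔼 x).map_target hy)
  rw [h1.fderiv_eq, fderiv_neg]

theorem linearization_gradient (g : RiemannianMetric n M) {f : M → ℝ}
    (hf : ContMDiff (𝓡 n) 𝓘(ℝ, ℝ) ∞ f) (x : M) :
    linearization (gradient g f) x =
      fderiv ℝ (chartField (gradient g f) x) (chartAt 𝔼 x x) := by
  have hyt : chartAt 𝔼 x x ∈ (chartAt 𝔼 x).target :=
    (chartAt 𝔼 x).map_source (mem_chart_source 𝔼 x)
  exact linearization_eq_fderiv (((contDiffOn_chartField_gradient g hf x).contDiffAt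
    ((chartAt 𝔼 x).open_target.mem_nhds hyt)).differentiableAt (by simp))

/-- The stable manifold is the stable set of the time-`τ` map for a small `τ > 0`, and the
linearization of that map is diagonal with eigenvalues `exp (-μ τ)`. -/
theorem exists_slice_chart_stableManifold [CompactSpace M] [T2Space M]
    (g : RiemannianMetric n M) {f : M → ℝ} (hf : IsMorse n f) {x : M}
    (hx : IsCritical (n := n) f x) :
    ∃ φ ψ : M → M, ContMDiff (𝓡 n) (𝓡 n) ∞ φ ∧ ContMDiff (𝓡 n) (𝓡 n) ∞ ψ ∧
      Function.LeftInverse ψ φ ∧ Function.LeftInverse φ ψ ∧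
      stableManifold (negGradient g f) x = stableSet φ x ∧ φ x = x ∧
      ∃ Θ ∈ IsManifold.maximalAtlas (𝓡 n) ∞ M, x ∈ Θ.source ∧ Θ x = 0 ∧
        Θ.source ⊆ (chartAt 𝔼 x).source ∧
        (∀ q ∈ Θ.source, q ∈ stableSet φ x ↔ Θ q ∈ (stableSubspace g f x : Submodule ℝ 𝔼)) ∧
        HasFDerivAt (Θ ∘ (chartAt 𝔼 x).symm) (ContinuousLinearMap.id ℝ 𝔼) (chartAt 𝔼 x x) ∧
        HasFDerivAt (chartAt 𝔼 x ∘ Θ.symm) (ContinuousLinearMap.id ℝ 𝔼) 0 := by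
  have : SecondCountableTopology M := ChartedSpace.secondCountable_of_sigmaCompact 𝔼 M
  have hX0 : negGradient g f x = 0 := by
    rw [negGradient, gradient_eq_zero_of_isCritical g hx]
    exact neg_zero
  obtain ⟨b, μ, hμ, hb⟩ := exists_eigenbasis_chartField_gradient g hf hx
  obtain ⟨ε, hε, θ, hθ, huniq, hadd, hsmooth, hcont, hder⟩ :=
    exists_flow (contDiffOn_chartField_negGradient g hf.smooth) x
  set τ := ε / 2 with hτ
  have hτ0 : 0 < τ := by positivity
  have hIcc : ∀ t ∈ Icc 0 τ, t ∈ Ioo (-ε) ε := fun t ht =>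
    ⟨by linarith [ht.1], by linarith [ht.2]⟩
  have hτε : τ ∈ Ioo (-ε) ε := hIcc τ ⟨hτ0.le, le_rfl⟩
  have hτε' : -τ ∈ Ioo (-ε) ε := ⟨by linarith, by linarith⟩
  have hfix : ∀ p, gradient g f p = 0 → ∀ t, θ t p = p := fun p hp t => by
    have h1 : negGradient g f p = 0 := by
      rw [negGradient, hp]
      exact neg_zero
    exact (congrFun (huniq p _ (isTrajectory_const h1)) t).symm
  have hxfix := hfix x (gradient_eq_zero_of_isCritical g hx)
  have h0 : ∀ q, θ 0 q = q := fun q => (hθ q).2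
  have hle : ∀ q, f (θ τ q) ≤ f q := fun q => by
    have h1 := antitone_comp_trajectory g hf.smooth (hθ q) hτ0.le
    simpa only [Function.comp_apply, h0] using h1
  have heq : ∀ q, f (θ τ q) = f q → θ τ q = q := fun q hq => by
    obtain ⟨t, -, ht⟩ := exists_gradient_eq_zero g hf.smooth (hθ q) hτ0
      (by simp only [h0]; exact hq.symm)
    have h1 := hfix _ ht (τ - t)
    have h2 := hfix _ ht (-t)
    rw [← hadd, sub_add_cancel] at h1
    rw [← hadd, neg_add_cancel, h0] at h2
    rw [h1, ← h2]
  let P : 𝔼 →L[ℝ] 𝔼 :=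
    LinearMap.toContinuousLinearMap (b.constr ℝ fun i => if 0 < μ i then b i else 0)
  have hP : ∀ i, P (b i) = if 0 < μ i then b i else 0 := fun i => b.constr_basis ℝ _ i
  have hβ1 : ∀ i, Real.exp (-μ i * τ) < 1 ↔ 0 < μ i := fun i => by
    rw [Real.exp_lt_one_iff, neg_mul, neg_lt_zero, mul_pos_iff_of_pos_right hτ0]
  obtain ⟨Θ, hΘ, hxΘ, hΘx, hsub, hS, hd, hd'⟩ := exists_slice_chart (hsmooth τ hτε)
    hf.smooth.continuous hle heq (hxfix τ) (b := b) (β := fun i => Real.exp (-μ i * τ)) (P := P)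
    rfl (fun i => Real.exp_pos _)
    (fun i => by
      rw [Ne, Real.exp_eq_one_iff]
      exact mul_ne_zero (neg_ne_zero.2 (hμ i)) hτ0.ne')
    (fun i => hder hX0 (-μ i) (b i) (by
      rw [fderiv_chartField_negGradient, _root_.neg_apply, hb, neg_smul]) τ hτε)
    (fun i => by rw [hP]; simp only [hβ1])
  have hstable : stableManifold (negGradient g f) x = stableSet (θ τ) x := by
    ext q
    rw [← omegaLimit_eq_singleton_iff h0 hadd hxfix hτ0
      (fun t ht => hcont t (hIcc t ht) x) q]
    constructor
    · rintro ⟨γ, hγ, hω⟩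
      rwa [← huniq q γ hγ]
    · exact fun h => ⟨_, hθ q, h⟩
  have hinv : ∀ s q, θ (-s) (θ s q) = q := fun s q => by rw [← hadd, neg_add_cancel, h0]
  refine ⟨θ τ, θ (-τ), hsmooth τ hτε, hsmooth (-τ) hτε', hinv τ, fun q => ?_, hstable, hxfix τ,
    Θ, hΘ, hxΘ, hΘx, hsub, fun q hq => ?_, hd, hd'⟩
  · simpa using hinv (-τ) q
  · rw [hS q hq]
    have h1 := mem_iSup_eigenspace_pos_iff (L := (fderiv ℝ (chartField (gradient g f) x)
      (chartAt 𝔼 x x)).toLinearMap) (P := P.toLinearMap) hb hP (Θ q)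
    rw [stableSubspace, linearization_gradient g hf.smooth]
    exact h1.symm

/-- The half of the stable manifold theorem that concerns the stable manifold. -/
theorem stableManifold_negGradient [CompactSpace M] [T2Space M]
    (g : RiemannianMetric n M) {f : M → ℝ} (hf : IsMorse n f) {x : M}
    (hx : IsCritical (n := n) f x) :
    x ∈ stableManifold (negGradient g f) x ∧
      IsEmbeddedSubmanifold n (Module.finrank ℝ (stableSubspace g f x))
        (stableManifold (negGradient g f) x) ∧
      tangentVectors (stableManifold (negGradient g f) x) x =
        (stableSubspace g f x : Set (TangentSpace (𝓡 n) x)) := by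
  obtain ⟨φ, ψ, hφ, hψ, hψφ, hφψ, hW, hφx, Θ, hΘ, hxΘ, hΘx, hsub, hS, hd, hd'⟩ :=
    exists_slice_chart_stableManifold g hf hx
  rw [hW]
  refine ⟨?_, isEmbeddedSubmanifold_stableSet hφ hψ hψφ hφψ hΘ hxΘ hS, ?_⟩
  · exact tendsto_const_nhds.congr fun k => (Function.iterate_fixed hφx k).symm
  · ext v
    exact mem_tangentVectors_iff_of_slice_chart hΘ hxΘ hΘx hsub hS hd hd' v

end Stable

/-! ### Reversal of the flow -/

section Unstable

variable {n : ℕ} {M : Type*} [TopologicalSpace M] [ChartedSpace (EuclideanSpace ℝ (Fin n)) M]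

local notation "𝔼" => EuclideanSpace ℝ (Fin n)

theorem IsCritical.neg {f : M → ℝ} {x : M} (hx : IsCritical (n := n) f x) :
    IsCritical (n := n) (-f) x := by
  rw [IsCritical, mfderiv_neg, hx]
  exact neg_zero

theorem isCritical_neg_iff {f : M → ℝ} {x : M} :
    IsCritical (n := n) (-f) x ↔ IsCritical (n := n) f x :=
  ⟨fun h => neg_neg f ▸ h.neg, IsCritical.neg⟩

theorem hessian_neg (f : M → ℝ) (x : M) : hessian (n := n) (-f) x = -hessian (n := n) f x := by
  have h1 : fderiv ℝ ((-f) ∘ (extChartAt (𝓡 n) x).symm) =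
      -fderiv ℝ (f ∘ (extChartAt (𝓡 n) x).symm) := by
    funext y
    exact fderiv_neg
  have h2 : fderiv ℝ (fderiv ℝ ((-f) ∘ (extChartAt (𝓡 n) x).symm)) (extChartAt (𝓡 n) x x) =
      -fderiv ℝ (fderiv ℝ (f ∘ (extChartAt (𝓡 n) x).symm)) (extChartAt (𝓡 n) x x) := by
    rw [h1, fderiv_neg]
  exact h2

theorem IsMorse.neg {f : M → ℝ} (hf : IsMorse n f) : IsMorse n (-f) where
  smooth := hf.smooth.neg
  nondegenerate x hx ξ hξ := by
    refine hf.nondegenerate x (isCritical_neg_iff.1 hx) ξ fun η => ?_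
    have h1 := hξ η
    rw [hessian_neg] at h1
    exact neg_eq_zero.1 h1

theorem IsTrajectory.reverse {X : (p : M) → TangentSpace (𝓡 n) p} {q : M} {γ : ℝ → M}
    (hγ : IsTrajectory X q γ) : IsTrajectory (fun p => -X p) q (fun t => γ (-t)) := by
  refine ⟨?_, by simpa using hγ.2⟩
  have h1 := hγ.1.comp_mul (-1)
  have h2 : (γ ∘ fun t => t * (-1 : ℝ)) = fun t => γ (-t) := by
    funext t
    simp
  have h3 : (-1 : ℝ) • X = fun p => -X p := by
    funext p
    exact neg_one_smul ℝ (X p)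
  rwa [h2, h3] at h1

/-- Time reversal exchanges the two limit sets. -/
theorem omegaLimit_reverse {M : Type*} [TopologicalSpace M] (γ : ℝ → M) :
    omegaLimit (fun t => γ (-t)) = alphaLimit γ := by
  ext p
  constructor
  · rintro ⟨t, ht, hp⟩
    exact ⟨fun k => -t k, tendsto_neg_atTop_atBot.comp ht, hp⟩
  · rintro ⟨t, ht, hp⟩
    exact ⟨fun k => -t k, tendsto_neg_atBot_atTop.comp ht, by simpa using hp⟩

variable [IsManifold (𝓡 n) ∞ M]

theorem gradient_neg (g : RiemannianMetric n M) (f : M → ℝ) :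
    gradient g (-f) = fun q => -gradient g f q := by
  funext q
  refine (existsUnique_gradient g (-f) q).unique (inner_gradient g (-f) q) fun v => ?_
  rw [mfderiv_neg]
  have h1 : g.inner q (-gradient g f q) v = -g.inner q (gradient g f q) v := by
    rw [map_neg]
    rfl
  rw [h1, inner_gradient]
  rfl

theorem negGradient_neg (g : RiemannianMetric n M) (f : M → ℝ) :
    negGradient g (-f) = fun q => -negGradient g f q := by
  funext q
  rw [negGradient, gradient_neg]
  rfl

/-- The negative gradient flow of `-f` is that of `f` with time reversed. -/
theorem unstableManifold_eq_stableManifold_neg (g : RiemannianMetric n M) (f : M → ℝ) (x : M) :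
    unstableManifold (negGradient g f) x = stableManifold (negGradient g (-f)) x := by
  rw [negGradient_neg]
  ext q
  constructor
  · rintro ⟨γ, hγ, h⟩
    exact ⟨_, hγ.reverse, by rwa [omegaLimit_reverse]⟩
  · rintro ⟨γ, hγ, h⟩
    refine ⟨fun t => γ (-t), ?_, ?_⟩
    · have h1 := hγ.reverse
      simp only [neg_neg] at h1
      exact h1
    · rw [← omegaLimit_reverse]
      simpa only [neg_neg] using h

theorem unstableSubspace_eq_stableSubspace_neg (g : RiemannianMetric n M) {f : M → ℝ}
    (hf : ContMDiff (𝓡 n) 𝓘(ℝ, ℝ) ∞ f) (x : M) :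
    unstableSubspace g f x = stableSubspace g (-f) x := by
  have hL : linearization (gradient g (-f)) x = -linearization (gradient g f) x := by
    have h1 : fderiv ℝ (chartField (gradient g (-f)) x) (chartAt 𝔼 x x) =
        -fderiv ℝ (chartField (gradient g f) x) (chartAt 𝔼 x x) := by
      rw [gradient_neg]
      exact fderiv_chartField_negGradient g f x
    exact (linearization_gradient g hf.neg x).trans
      (h1.trans (congrArg Neg.neg (linearization_gradient g hf x)).symm)
  have heig : ∀ c : ℝ, Module.End.eigenspace (linearization (gradient g (-f)) x).toLinearMap c =
      Module.End.eigenspace (linearization (gradient g f) x).toLinearMap (-c) := by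
    intro c
    ext v
    rw [Module.End.mem_eigenspace_iff, Module.End.mem_eigenspace_iff, hL, neg_smul]
    exact neg_eq_iff_eq_neg
  rw [unstableSubspace, stableSubspace]
  refine le_antisymm (iSup_le fun c => ?_) (iSup_le fun c => ?_)
  · refine le_iSup_of_le ⟨-c, neg_pos.2 c.2⟩ ?_
    rw [heig, neg_neg]
  · refine le_iSup_of_le ⟨-c, neg_lt_zero.2 c.2⟩ ?_
    rw [heig]

end Unstable

end MorseFlow

theorem mainTheorem9 (n : ℕ) (M : Type*) [TopologicalSpace M]
    [ChartedSpace (EuclideanSpace ℝ (Fin n)) M] [IsManifold (𝓡 n) ∞ M]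
    [CompactSpace M] [T2Space M]
    (g : MorseFlow.RiemannianMetric n M) (f : M → ℝ) (hf : MorseFlow.IsMorse n f)
    (x : M) (hx : MorseFlow.IsCritical (n := n) f x) :
    (x ∈ MorseFlow.stableManifold (MorseFlow.negGradient g f) x ∧
      MorseFlow.IsEmbeddedSubmanifold n (Module.finrank ℝ (MorseFlow.stableSubspace g f x))
        (MorseFlow.stableManifold (MorseFlow.negGradient g f) x) ∧
      MorseFlow.tangentVectors (MorseFlow.stableManifold (MorseFlow.negGradient g f) x) x =
        (MorseFlow.stableSubspace g f x : Set (TangentSpace (𝓡 n) x))) ∧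
    (x ∈ MorseFlow.unstableManifold (MorseFlow.negGradient g f) x ∧
      MorseFlow.IsEmbeddedSubmanifold n (Module.finrank ℝ (MorseFlow.unstableSubspace g f x))
        (MorseFlow.unstableManifold (MorseFlow.negGradient g f) x) ∧
      MorseFlow.tangentVectors (MorseFlow.unstableManifold (MorseFlow.negGradient g f) x) x =
        (MorseFlow.unstableSubspace g f x : Set (TangentSpace (𝓡 n) x))) := by
  refine ⟨MorseFlow.stableManifold_negGradient g hf hx, ?_⟩
  rw [MorseFlow.unstableManifold_eq_stableManifold_neg,
    MorseFlow.unstableSubspace_eq_stableSubspace_neg g hf.smooth]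
  exact MorseFlow.stableManifold_negGradient g hf.neg hx.neg
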